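/- An overpartition of a nonnegative integer $n$ is a partition of $n$ in which the first occurrence of each distinct number may be overlined. Let $\overline{spt1}(n)$ (resp. $\overline{spt2}(n)$) denote the sum, over all overpartitions $\lambda$ of $n$ whose smallest part is odd (resp. even), of the number of occurrences (overlined or not) of the smallest part of $\lambda$; the empty overpartition of $0$ contributes $0$. Let $\overline{spt}(n) = \overline{spt1}(n) + \overline{spt2}(n)$. For example, $\overline{spt1}(4) = 20$, $\overline{spt2}(4) = 6$ and $\overline{spt}(4) = 26$. Then for every integer $n \geq 0$, $$\overline{spt2}(3n) \equiv \overline{spt2}(3n+1) \equiv 0 \pmod{3},$$ $$\overline{spt}(3n) \equiv 0 \pmod{3},$$ $$\overline{spt2}(5n+3) \equiv 0 \pmod{5},$$ and $$\overline{spt1}(5n) \equiv 0 \pmod{5}.$$ -/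

import Mathlib

/-- An overpartition of `n`: a partition of `n` in which the first occurrence of each distinct
part may be overlined. It is recorded as the underlying partition together with the set of those
part sizes whose first occurrence is overlined. -/
structure Overpartition (n : ℕ) where
  partition : n.Partition
  overlined : Finset ℕ
  overlined_subset : overlined ⊆ partition.parts.toFinset

namespace Overpartition

/-- An overpartition is a partition with a subset of its set of part sizes. -/
def equivSigma (n : ℕ) :
    Overpartition n ≃ Σ p : n.Partition, {S : Finset ℕ // S ∈ p.parts.toFinset.powerset} where
  toFun l := ⟨l.partition, l.overlined, Finset.mem_powerset.mpr l.overlined_subset⟩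
  invFun x := ⟨x.1, x.2.1, Finset.mem_powerset.mp x.2.2⟩
  left_inv _ := rfl
  right_inv _ := rfl

instance instFintype (n : ℕ) : Fintype (Overpartition n) :=
  Fintype.ofEquiv _ (equivSigma n).symm

/-- The smallest part (as a number) of an overpartition; `0` for the empty overpartition,
which has no parts. -/
def smallestPart {n : ℕ} (l : Overpartition n) : ℕ :=
  l.partition.parts.toFinset.min.untopD 0

/-- The number of occurrences of the smallest part, overlined or not; `0` for the empty
overpartition. -/
def smallestPartCount {n : ℕ} (l : Overpartition n) : ℕ :=
  l.partition.parts.count l.smallestPart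

end Overpartition

/-- The sum, over all overpartitions of `n` whose smallest part is odd, of the number of
occurrences of the smallest part. -/
def sptBar1 (n : ℕ) : ℕ :=
  ∑ l : Overpartition n, if Odd l.smallestPart then l.smallestPartCount else 0

/-- The sum, over all overpartitions of `n` whose smallest part is even, of the number of
occurrences of the smallest part. -/
def sptBar2 (n : ℕ) : ℕ :=
  ∑ l : Overpartition n, if Even l.smallestPart then l.smallestPartCount else 0

/-- The sum, over all overpartitions of `n`, of the number of occurrences of the smallest part,
split by the parity of the smallest part. -/
def sptBar (n : ℕ) : ℕ :=
  sptBar1 n + sptBar2 n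

/-! Write D = q d/dq, θ = ∑ (-1)^t q^(t²), (q)_n = ∏_{i≤n} (1 - q^i), (-q)_n = ∏_{i≤n} (1 + q^i),
and let S and T be the generating functions of spt2 and spt. Since D multiplies the n-th coefficient
by n, the congruences follow from differential forms of S and T: S + DS ≡ 0 and T - 2S ≡ D(1/θ)
modulo 3, and S ≡ DH - 3H and T - S ≡ DH' modulo 5 for suitable series H, H'.

Generating functions. The overpartitions with smallest part j, weighted by its multiplicity,
contribute 2 q^j/(1-q^j)² · ∏_{i>j} (1+q^i)/(1-q^i). As 1/θ is the overpartition series, θT and θS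
are the sums of 2 q^j/(1-q^j)² · (q)_j/(-q)_j over all j and over even j. A limiting case of
Bailey's lemma (`sum_baileySum`), applied to three explicit pairs, yields θS = 2σ(q²) + 4R_1 and θT
= 2σ(q) - 4σ(q²) + 8R_1, where σ is the divisor-sum series and R_k = ∑ (-1)^a m^k q^(a²+2am) over a,
m ≥ 1 (`theta_mul_sptSeriesEven`, `theta_mul_sptSeries`).

Differential relations. For k = 1 and 3 the combination θ DR_k + θ R_(k+2) - Dθ R_k collapses, by
sign-reversing symmetries of a ternary sum, to derivatives of θ and divisor series
(`eight_mul_heatSeries_one`, `twenty_four_mul_heatSeries_three`). By Fermat, R_3 ≡ R_1 modulo 3 and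
R_5 ≡ R_1 modulo 5, so the chain of relations closes. Together with Dθ = 2(σ(q²) - σ(q))θ and
Ramanujan's formula for σ², what remains is algebra in a differential ring of characteristic 3 or 5
(`add_derivation_eq_zero_of_three_eq_zero`, `sub_eq_derivation_of_three_eq_zero`,
`eq_derivation_sub_of_five_eq_zero`). -/

open PowerSeries

/-! ### Formal q-sums over arbitrary index types -/

/-- The power series `∑ i, w i * q ^ e i`. -/
noncomputable def qSum {ι R : Type*} [CommRing R] (e : ι → ℤ) (w : ι → R) : R⟦X⟧ :=
  PowerSeries.mk fun n => ∑ᶠ i, if e i = n then w i else 0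

/-- The exponents of the nonzero terms are nonnegative, and finitely many terms lie below any
given degree. -/
structure QSummable {ι R : Type*} [CommRing R] (e : ι → ℤ) (w : ι → R) : Prop where
  nonneg : ∀ i, w i ≠ 0 → 0 ≤ e i
  finite : ∀ N : ℤ, {i | w i ≠ 0 ∧ e i ≤ N}.Finite

section QSum

variable {ι κ R S : Type*} [CommRing R] [CommRing S]

theorem QSummable.mono {e : ι → ℤ} {w : ι → R} {v : ι → S} (h : QSummable e w)
    (hv : ∀ i, v i ≠ 0 → w i ≠ 0) : QSummable e v :=
  ⟨fun i hi => h.nonneg i (hv i hi), fun N => (h.finite N).subset fun i hi => ⟨hv i hi.1, hi.2⟩⟩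

theorem coeff_qSum_eq_sum {e : ι → ℤ} {w : ι → R} (n : ℕ) (s : Finset ι)
    (hs : ∀ i, w i ≠ 0 → e i = n → i ∈ s) :
    coeff n (qSum e w) = ∑ i ∈ s, if e i = n then w i else 0 := by
  rw [qSum, coeff_mk]
  apply finsum_eq_sum_of_support_subset
  intro i hi
  simp only [Function.mem_support, ne_eq, ite_eq_right_iff, Classical.not_imp] at hi
  exact hs i hi.2 hi.1

theorem QSummable.exists_finset {e : ι → ℤ} {w : ι → R} (h : QSummable e w) (N : ℤ) :
    ∃ s : Finset ι, ∀ i, w i ≠ 0 → e i ≤ N → i ∈ s :=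
  ⟨(h.finite N).toFinset, fun i h1 h2 => by simp [h1, h2]⟩

theorem qSum_congr {e e' : ι → ℤ} {w w' : ι → R} (hw : ∀ i, w i = w' i)
    (he : ∀ i, w i ≠ 0 → e i = e' i) : qSum e w = qSum e' w' := by
  ext n
  simp only [qSum, coeff_mk]
  apply finsum_congr
  intro i
  rw [← hw]
  by_cases h : w i = 0
  · simp [h]
  · rw [he i h]

theorem qSum_equiv (σ : ι ≃ κ) (e : κ → ℤ) (w : κ → R) :
    qSum (fun i => e (σ i)) (fun i => w (σ i)) = qSum e w := by
  ext n
  simp only [qSum, coeff_mk]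
  exact finsum_comp_equiv σ (f := fun i => if e i = n then w i else 0)

theorem qSum_zero (e : ι → ℤ) : qSum e (fun _ => (0 : R)) = 0 := by
  ext n
  simp [qSum]

theorem qSum_add {e : ι → ℤ} {w v : ι → R} (hw : QSummable e w) (hv : QSummable e v) :
    qSum e (fun i => w i + v i) = qSum e w + qSum e v := by
  classical
  ext n
  obtain ⟨s, hs⟩ := hw.exists_finset n
  obtain ⟨t, ht⟩ := hv.exists_finset n
  rw [map_add, coeff_qSum_eq_sum n (s ∪ t), coeff_qSum_eq_sum n (s ∪ t),
    coeff_qSum_eq_sum n (s ∪ t), ← Finset.sum_add_distrib]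
  · exact Finset.sum_congr rfl fun i _ => by split_ifs <;> simp
  · exact fun i h h' => Finset.mem_union_right _ (ht i h h'.le)
  · exact fun i h h' => Finset.mem_union_left _ (hs i h h'.le)
  · intro i h h'
    by_cases h0 : w i = 0
    · exact Finset.mem_union_right _ (ht i (by simpa [h0] using h) h'.le)
    · exact Finset.mem_union_left _ (hs i h0 h'.le)

theorem qSum_const_mul {e : ι → ℤ} {w : ι → R} (hw : QSummable e w) (c : R) :
    qSum e (fun i => c * w i) = C c * qSum e w := by
  ext n
  obtain ⟨s, hs⟩ := hw.exists_finset n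
  rw [coeff_C_mul, coeff_qSum_eq_sum n s, coeff_qSum_eq_sum n s, Finset.mul_sum]
  · exact Finset.sum_congr rfl fun i _ => by split_ifs <;> simp
  · exact fun i h h' => hs i h h'.le
  · exact fun i h h' => hs i (right_ne_zero_of_mul h) h'.le

theorem QSummable.add {e : ι → ℤ} {w v : ι → R} (hw : QSummable e w) (hv : QSummable e v) :
    QSummable e (fun i => w i + v i) := by
  have key : ∀ i, w i + v i ≠ 0 → w i ≠ 0 ∨ v i ≠ 0 := fun i h => by
    by_contra! h'
    simp [h'.1, h'.2] at h
  refine ⟨fun i hi => (key i hi).elim (hw.nonneg i) (hv.nonneg i), fun N => ?_⟩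
  refine ((hw.finite N).union (hv.finite N)).subset fun i hi => ?_
  exact (key i hi.1).imp (fun h => ⟨h, hi.2⟩) (fun h => ⟨h, hi.2⟩)

theorem QSummable.mul_left {e : ι → ℤ} {w : ι → R} (h : QSummable e w) (c : ι → R) :
    QSummable e (fun i => c i * w i) := h.mono fun _ hi => right_ne_zero_of_mul hi

theorem QSummable.mul {e : ι → ℤ} {w : ι → R} {f : κ → ℤ} {v : κ → R} (hw : QSummable e w)
    (hv : QSummable f v) :
    QSummable (fun p : ι × κ => e p.1 + f p.2) (fun p => w p.1 * v p.2) := by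
  refine ⟨fun p hp => add_nonneg (hw.nonneg _ (left_ne_zero_of_mul hp))
    (hv.nonneg _ (right_ne_zero_of_mul hp)), fun N => ?_⟩
  refine ((hw.finite N).prod (hv.finite N)).subset fun p hp => ?_
  have h1 := left_ne_zero_of_mul hp.1
  have h2 := right_ne_zero_of_mul hp.1
  have h3 := hw.nonneg _ h1
  have h4 := hv.nonneg _ h2
  have h5 := hp.2
  exact ⟨⟨h1, by omega⟩, ⟨h2, by omega⟩⟩

theorem qSum_mul {e : ι → ℤ} {w : ι → R} {f : κ → ℤ} {v : κ → R} (hw : QSummable e w)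
    (hv : QSummable f v) :
    qSum e w * qSum f v = qSum (fun p : ι × κ => e p.1 + f p.2) (fun p => w p.1 * v p.2) := by
  classical
  ext n
  obtain ⟨s, hs⟩ := hw.exists_finset n
  obtain ⟨t, ht⟩ := hv.exists_finset n
  rw [coeff_qSum_eq_sum n (s ×ˢ t), coeff_mul]
  · have h1 : ∀ p ∈ Finset.HasAntidiagonal.antidiagonal n,
        coeff p.1 (qSum e w) * coeff p.2 (qSum f v) =
        ∑ x ∈ s ×ˢ t, if e x.1 = p.1 ∧ f x.2 = p.2 then w x.1 * v x.2 else 0 := by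
      intro p hp
      have hp' := Finset.HasAntidiagonal.mem_antidiagonal.mp hp
      rw [coeff_qSum_eq_sum p.1 s fun i h h' => hs i h (by omega),
        coeff_qSum_eq_sum p.2 t fun i h h' => ht i h (by omega), Finset.sum_mul_sum,
        Finset.sum_product]
      refine Finset.sum_congr rfl fun i _ => Finset.sum_congr rfl fun j _ => ?_
      by_cases h1 : e i = p.1 <;> by_cases h2 : f j = p.2 <;> simp [h1, h2]
    rw [Finset.sum_congr rfl h1, Finset.sum_comm]
    refine Finset.sum_congr rfl fun x _ => ?_
    -- For a nonzero product both exponents are nonnegative, so the pair meets exactly one point of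
    -- the antidiagonal, or none.
    by_cases h0 : w x.1 * v x.2 = 0
    · simp [h0]
    have he := hw.nonneg _ (left_ne_zero_of_mul h0)
    have hf := hv.nonneg _ (right_ne_zero_of_mul h0)
    rw [← Finset.sum_filter, Finset.sum_const]
    split_ifs with h
    · have : Finset.filter (fun p : ℕ × ℕ => e x.1 = p.1 ∧ f x.2 = p.2)
          (Finset.HasAntidiagonal.antidiagonal n) = {((e x.1).toNat, (f x.2).toNat)} := by
        ext ⟨a, b⟩
        simp only [Finset.mem_filter, Finset.HasAntidiagonal.mem_antidiagonal, Finset.mem_singleton,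
          Prod.mk.injEq]
        omega
      rw [this, Finset.card_singleton, one_smul]
    · have : Finset.filter (fun p : ℕ × ℕ => e x.1 = p.1 ∧ f x.2 = p.2)
          (Finset.HasAntidiagonal.antidiagonal n) = ∅ := by
        ext ⟨a, b⟩
        simp only [Finset.mem_filter, Finset.HasAntidiagonal.mem_antidiagonal,
          Finset.notMem_empty, iff_false]
        omega
      rw [this, Finset.card_empty, zero_smul]
  · intro p h h'
    have h1 := left_ne_zero_of_mul h
    have h2 := right_ne_zero_of_mul h
    have h3 := hw.nonneg _ h1
    have h4 := hv.nonneg _ h2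
    exact Finset.mem_product.mpr ⟨hs _ h1 (by omega), ht _ h2 (by omega)⟩

/-- A double sum, one variable at a time. -/
theorem coeff_qSum_prod {e : ι × κ → ℤ} {w : ι × κ → R} (h : QSummable e w) (n : ℕ)
    (s : Finset ι) (hs : ∀ p, w p ≠ 0 → e p = n → p.1 ∈ s) :
    coeff n (qSum e w) =
      ∑ i ∈ s, coeff n (qSum (fun k => e (i, k)) (fun k => w (i, k))) := by
  classical
  obtain ⟨t, ht⟩ := h.exists_finset n
  have h2 : ∀ i ∈ s, coeff n (qSum (fun k => e (i, k)) (fun k => w (i, k))) =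
      ∑ k ∈ t.image Prod.snd, if e (i, k) = n then w (i, k) else 0 := fun i _ =>
    coeff_qSum_eq_sum n _ fun k h h' =>
      Finset.mem_image.mpr ⟨(i, k), ht _ h h'.le, rfl⟩
  rw [Finset.sum_congr rfl h2, ← Finset.sum_product', coeff_qSum_eq_sum]
  exact fun p h h' => Finset.mem_product.mpr
    ⟨hs p h h', Finset.mem_image.mpr ⟨p, ht p h h'.le, rfl⟩⟩

theorem map_qSum (f : R →+* S) {e : ι → ℤ} {w : ι → R} (h : QSummable e w) :
    PowerSeries.map f (qSum e w) = qSum e (fun i => f (w i)) := by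
  ext n
  obtain ⟨s, hs⟩ := h.exists_finset n
  rw [coeff_map, coeff_qSum_eq_sum n s fun i h h' => hs i h h'.le,
    coeff_qSum_eq_sum n s fun i h h' => hs i (fun h0 => h (by simp [h0])) h'.le, map_sum]
  exact Finset.sum_congr rfl fun i _ => by split_ifs <;> simp

end QSum

/-! ### The derivation q d/dq -/

/-- The derivation `q d/dq` on power series. -/
noncomputable def qDeriv (R : Type*) [CommRing R] : Derivation R R⟦X⟧ R⟦X⟧ :=
  (X : R⟦X⟧) • PowerSeries.derivative R

section QDeriv

variable {ι R S : Type*} [CommRing R] [CommRing S]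

theorem coeff_qDeriv (f : R⟦X⟧) (n : ℕ) : coeff n (qDeriv R f) = n * coeff n f := by
  cases n with
  | zero => simp [qDeriv]
  | succ n => simp [qDeriv, coeff_succ_X_mul, coeff_derivative, mul_comm]

theorem qDeriv_qSum {e : ι → ℤ} {w : ι → R} (h : QSummable e w) :
    qDeriv R (qSum e w) = qSum e (fun i => (e i : R) * w i) := by
  ext n
  obtain ⟨s, hs⟩ := h.exists_finset n
  rw [coeff_qDeriv, coeff_qSum_eq_sum n s fun i h h' => hs i h h'.le,
    coeff_qSum_eq_sum n s fun i h h' => hs i (right_ne_zero_of_mul h) h'.le, Finset.mul_sum]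
  refine Finset.sum_congr rfl fun i _ => ?_
  split_ifs with h
  · rw [h]; simp
  · simp

theorem map_qDeriv (f : R →+* S) (g : R⟦X⟧) :
    PowerSeries.map f (qDeriv R g) = qDeriv S (PowerSeries.map f g) := by
  ext n
  simp [coeff_qDeriv]

end QDeriv

/-! ### Theta, Lambert and rank series -/

/-- The sign `(-1) ^ t` for an integer `t`. -/
def intSign (t : ℤ) : ℤ := (Int.negOnePow t : ℤˣ)

theorem intSign_add (a b : ℤ) : intSign (a + b) = intSign a * intSign b := by
  simp [intSign, Int.negOnePow_add]

theorem intSign_neg (a : ℤ) : intSign (-a) = intSign a := by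
  simp [intSign, Int.negOnePow_neg]

/-- The theta series `∑ (-1)^t t^j q^(t^2)` over all integers `t`. -/
noncomputable def thetaMoment (j : ℕ) : ℤ⟦X⟧ := qSum (fun t : ℤ => t ^ 2) fun t => intSign t * t ^ j

/-- The theta series `∑ (-1)^t q^(t^2)` over all integers `t`. -/
noncomputable def theta : ℤ⟦X⟧ := thetaMoment 0

/-- The series `∑ p (a, b) q^(d a b)` over positive integers `a`, `b`. -/
noncomputable def lambert (d : ℤ) (p : ℤ × ℤ → ℤ) : ℤ⟦X⟧ :=
  qSum (fun x : ℤ × ℤ => d * (x.1 * x.2)) fun x => if 1 ≤ x.1 ∧ 1 ≤ x.2 then p x else 0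

/-- The series `∑ σ_k(n) q^(d n)`. -/
noncomputable def sigmaSeries (k : ℕ) (d : ℤ) : ℤ⟦X⟧ := lambert d fun x => x.1 ^ k

/-- The indefinite theta series `∑ (-1)^a m^k q^(a^2 + 2 a m)` over positive integers `a`, `m`. -/
noncomputable def rankSeries (k : ℕ) : ℤ⟦X⟧ :=
  qSum (fun x : ℤ × ℤ => x.1 ^ 2 + 2 * (x.1 * x.2)) fun x =>
    if 1 ≤ x.1 ∧ 1 ≤ x.2 then intSign x.1 * x.2 ^ k else 0

theorem qSummable_sq {R : Type*} [CommRing R] (w : ℤ → R) :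
    QSummable (fun t : ℤ => t ^ 2) w := by
  refine ⟨fun t _ => sq_nonneg t, fun N => (Set.finite_Icc (-N) N).subset fun t ht => ?_⟩
  have := ht.2
  constructor <;> nlinarith

theorem qSummable_of_pos {R : Type*} [CommRing R] {e : ℤ × ℤ → ℤ} (p : ℤ × ℤ → R)
    (he : ∀ x : ℤ × ℤ, 1 ≤ x.1 → 1 ≤ x.2 → x.1 ≤ e x ∧ x.2 ≤ e x) :
    QSummable e fun x => if 1 ≤ x.1 ∧ 1 ≤ x.2 then p x else 0 := by
  refine ⟨fun x hx => ?_, fun N => ?_⟩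
  · have h : 1 ≤ x.1 ∧ 1 ≤ x.2 := by by_contra h; exact hx (if_neg h)
    linarith [(he x h.1 h.2).1]
  · refine ((Set.finite_Icc 1 N).prod (Set.finite_Icc 1 N)).subset fun x hx => ?_
    have h : 1 ≤ x.1 ∧ 1 ≤ x.2 := by by_contra h; exact hx.1 (if_neg h)
    have := he x h.1 h.2
    have := hx.2
    exact ⟨⟨h.1, by linarith⟩, ⟨h.2, by linarith⟩⟩

theorem qSummable_lambert {d : ℤ} (hd : 1 ≤ d) (p : ℤ × ℤ → ℤ) :
    QSummable (fun x : ℤ × ℤ => d * (x.1 * x.2)) fun x => if 1 ≤ x.1 ∧ 1 ≤ x.2 then p x else 0 := by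
  refine qSummable_of_pos p fun x h1 h2 => ?_
  have : x.1 * x.2 ≤ d * (x.1 * x.2) := by
    nlinarith [mul_pos (show 0 < x.1 by omega) (show 0 < x.2 by omega)]
  constructor <;> nlinarith

theorem qSummable_rankSeries (p : ℤ × ℤ → ℤ) :
    QSummable (fun x : ℤ × ℤ => x.1 ^ 2 + 2 * (x.1 * x.2))
      fun x => if 1 ≤ x.1 ∧ 1 ≤ x.2 then p x else 0 :=
  qSummable_of_pos p fun x h1 h2 => by constructor <;> nlinarith

/-- Even theta moments are thus iterated derivatives of `theta`; the odd ones vanish by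
`thetaMoment_odd`. -/
theorem qDeriv_thetaMoment (j : ℕ) : qDeriv ℤ (thetaMoment j) = thetaMoment (j + 2) := by
  rw [thetaMoment, qDeriv_qSum (qSummable_sq _)]
  exact qSum_congr (fun t => by push_cast; ring) fun _ _ => rfl

/-- The reflection t ↦ -t negates every summand, so the series equals its own negative. -/
theorem thetaMoment_odd (j : ℕ) (hj : Odd j) : thetaMoment j = 0 := by
  have h : thetaMoment j + thetaMoment j = 0 := by
    conv_lhs => rw [thetaMoment, ← qSum_equiv (Equiv.neg ℤ)]
    have h2 : qSum (fun i : ℤ => (Equiv.neg ℤ i) ^ 2)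
        (fun i => intSign (Equiv.neg ℤ i) * (Equiv.neg ℤ i) ^ j) =
        qSum (fun t : ℤ => t ^ 2) fun t => -(intSign t * t ^ j) :=
      qSum_congr (fun t => by simp [intSign_neg, hj.neg_pow]) fun t _ => by simp
    nth_rewrite 1 [h2]
    rw [qSum_equiv (Equiv.neg ℤ) (fun t : ℤ => t ^ 2) (fun t => intSign t * t ^ j),
      ← qSum_add (qSummable_sq _) (qSummable_sq _), ← qSum_zero (fun t : ℤ => t ^ 2)]
    exact qSum_congr (fun t => by ring) fun _ _ => rfl
  ext n
  have := congrArg (coeff n) h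
  simp only [map_add, map_zero] at this ⊢
  omega

theorem lambert_add {d : ℤ} (hd : 1 ≤ d) (p r : ℤ × ℤ → ℤ) :
    lambert d (fun x => p x + r x) = lambert d p + lambert d r := by
  rw [lambert, lambert, lambert, ← qSum_add (qSummable_lambert hd p) (qSummable_lambert hd r)]
  exact qSum_congr (fun x => by split_ifs <;> simp) fun _ _ => rfl

theorem lambert_const_mul {d : ℤ} (hd : 1 ≤ d) (c : ℤ) (p : ℤ × ℤ → ℤ) :
    lambert d (fun x => c * p x) = C c * lambert d p := by
  rw [lambert, lambert, ← qSum_const_mul (qSummable_lambert hd p)]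
  exact qSum_congr (fun x => by split_ifs <;> simp) fun _ _ => rfl

theorem lambert_swap (d : ℤ) (p : ℤ × ℤ → ℤ) : lambert d (fun x => p x.swap) = lambert d p := by
  rw [lambert, lambert, ← qSum_equiv (Equiv.prodComm ℤ ℤ)]
  refine qSum_congr (fun x => ?_) fun x _ => ?_
  · simp [and_comm]
  · simp [mul_comm]

theorem qDeriv_lambert {d : ℤ} (hd : 1 ≤ d) (p : ℤ × ℤ → ℤ) :
    qDeriv ℤ (lambert d p) = C d * lambert d (fun x => x.1 * x.2 * p x) := by
  rw [← lambert_const_mul hd, lambert, qDeriv_qSum (qSummable_lambert hd p)]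
  exact qSum_congr (fun x => by split_ifs <;> push_cast <;> ring) fun _ _ => rfl

theorem lambert_add_swap {d : ℤ} (hd : 1 ≤ d) (p : ℤ × ℤ → ℤ) :
    lambert d (fun x => p x + p x.swap) = 2 * lambert d p := by
  rw [lambert_add hd, lambert_swap]; ring

theorem lambert_linear_sum :
    lambert 2 (fun x => x.1 + x.2) = 2 * sigmaSeries 1 2 := by
  rw [sigmaSeries, ← lambert_add_swap (by norm_num)]
  simp

/-- (a+b)(b-a)² = a³ + b³ - ab(a+b), and D brings down the exponent 2ab. -/
theorem lambert_cubic_sum :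
    lambert 2 (fun x => (x.1 + x.2) * (x.2 - x.1) ^ 2) =
      2 * sigmaSeries 3 2 - qDeriv ℤ (sigmaSeries 1 2) := by
  rw [sigmaSeries, sigmaSeries, qDeriv_lambert (by norm_num), ← lambert_add_swap (by norm_num),
    eq_sub_iff_add_eq, ← show (2 : ℤ⟦X⟧) = C 2 from (map_ofNat _ 2).symm,
    ← lambert_add_swap (by norm_num), ← lambert_add (by norm_num)]
  congr 1
  ext x
  simp only [Prod.fst_swap, Prod.snd_swap]
  ring

/-- (a+b)(b-a)⁴ = a⁵ + b⁵ - 3ab(a³+b³) + 2(ab)²(a+b), where each factor 2ab is one application of D.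
-/
theorem lambert_quintic_sum :
    lambert 2 (fun x => (x.1 + x.2) * (x.2 - x.1) ^ 4) =
      2 * sigmaSeries 5 2 - 3 * qDeriv ℤ (sigmaSeries 3 2)
        + qDeriv ℤ (qDeriv ℤ (sigmaSeries 1 2)) := by
  have h2 : (2 : ℤ⟦X⟧) = C 2 := (map_ofNat _ 2).symm
  have h3 : (3 : ℤ⟦X⟧) = C 3 := (map_ofNat _ 3).symm
  have hd : (1 : ℤ) ≤ 2 := by norm_num
  have hD3 : qDeriv ℤ (sigmaSeries 3 2) =
      lambert 2 fun x => x.1 * x.2 * x.1 ^ 3 + x.2 * x.1 * x.2 ^ 3 := by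
    rw [sigmaSeries, qDeriv_lambert hd, ← h2, ← lambert_add_swap hd]
    rfl
  have hD1 : qDeriv ℤ (qDeriv ℤ (sigmaSeries 1 2)) =
      lambert 2 fun x => 2 * (x.1 * x.2) ^ 2 * x.1 + 2 * (x.2 * x.1) ^ 2 * x.2 := by
    rw [sigmaSeries, qDeriv_lambert hd, ← lambert_const_mul hd, qDeriv_lambert hd, ← h2,
      ← lambert_add_swap hd]
    congr 1
    ext x
    simp only [Prod.fst_swap, Prod.snd_swap]
    ring
  rw [hD3, hD1, sigmaSeries, ← lambert_add_swap hd, h3, ← lambert_const_mul hd, add_comm,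
    ← add_sub_assoc, eq_sub_iff_add_eq, ← lambert_add hd, ← lambert_add hd]
  congr 1
  ext x
  simp only [Prod.fst_swap]
  ring

/-! ### The heat operator on rank series -/

/-- The substitution `k = t - a`, `m = t - a + b` carries the exponent `t^2 + 2ab` to
`k^2 + a^2 + 2am`. -/
def shearEquiv : ℤ × ℤ × ℤ ≃ ℤ × ℤ × ℤ where
  toFun x := (x.1 - x.2.1, x.2.1, x.1 - x.2.1 + x.2.2)
  invFun x := (x.1 + x.2.1, x.2.1, x.2.2 - x.1)
  left_inv x := by ext <;> simp
  right_inv x := by ext <;> simp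

/-- The involution exchanging `k` and `r = a + m`. -/
def exchangeEquiv : ℤ × ℤ × ℤ ≃ ℤ × ℤ × ℤ where
  toFun x := (x.2.1 + x.2.2, x.1 - x.2.2, x.2.2)
  invFun x := (x.2.1 + x.2.2, x.1 - x.2.2, x.2.2)
  left_inv x := by ext <;> simp
  right_inv x := by ext <;> simp

/-- The involution `(t, a, b) ↦ (-t, b, a)`. -/
def reflectEquiv : ℤ × ℤ × ℤ ≃ ℤ × ℤ × ℤ where
  toFun x := (-x.1, x.2.2, x.2.1)
  invFun x := (-x.1, x.2.2, x.2.1)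
  left_inv x := by ext <;> simp
  right_inv x := by ext <;> simp

/-- The heat operator applied to the rank series, cleared of its theta denominator. -/
noncomputable def heatSeries (k : ℕ) : ℤ⟦X⟧ :=
  theta * qDeriv ℤ (rankSeries k) + theta * rankSeries (k + 2) - qDeriv ℤ theta * rankSeries k

theorem qSummable_theta_mul {e : ℤ × ℤ → ℤ} {w : ℤ × ℤ → ℤ} (h : QSummable e w)
    (v : ℤ × ℤ × ℤ → ℤ) (hv : ∀ x, v x ≠ 0 → w x.2 ≠ 0) :
    QSummable (fun x : ℤ × ℤ × ℤ => x.1 ^ 2 + e x.2) v := by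
  classical
  refine ((qSummable_sq (fun _ => (1 : ℤ))).mul h).mono fun x hx => ?_
  simpa using hv x hx

/-- With theta index u, the three terms supply a² + 2am, m² and -u². They add up to (a+m)² - u²,
which is antisymmetric under u ↔ a+m; `heatSeries` is designed for this. -/
theorem heatSeries_eq_qSum (k : ℕ) :
    heatSeries k = qSum (fun x : ℤ × ℤ × ℤ => x.1 ^ 2 + (x.2.1 ^ 2 + 2 * (x.2.1 * x.2.2)))
      fun x => if 1 ≤ x.2.1 ∧ 1 ≤ x.2.2 then
        intSign (x.1 + x.2.1) * ((x.2.1 + x.2.2) ^ 2 - x.1 ^ 2) * x.2.2 ^ k else 0 := by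
  have hr := fun p => qSummable_rankSeries p
  rw [heatSeries, sub_eq_iff_eq_add, theta, qDeriv_thetaMoment, rankSeries,
    qDeriv_qSum (hr _), thetaMoment, rankSeries, qSum_mul (qSummable_sq _) ((hr _).mul_left _),
    qSum_mul (qSummable_sq _) (hr _), thetaMoment, qSum_mul (qSummable_sq _) (hr _),
    ← qSum_add, ← qSum_add]
  · refine qSum_congr (fun x => ?_) fun _ _ => rfl
    split_ifs
    · rw [intSign_add]; push_cast; ring
    · simp
  all_goals
    refine qSummable_theta_mul (hr fun _ => 1) _ fun x hx => ?_
    by_contra h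
    have h' : ¬(1 ≤ x.2.1 ∧ 1 ≤ x.2.2) := by simpa using h
    exact hx (by simp only [if_neg h', mul_zero])

theorem QSummable.equiv {ι κ R : Type*} [CommRing R] {e : κ → ℤ} {w : κ → R} (h : QSummable e w)
    (σ : ι ≃ κ) : QSummable (fun i => e (σ i)) (fun i => w (σ i)) :=
  ⟨fun i hi => h.nonneg (σ i) hi, fun N => (h.finite N).preimage σ.injective.injOn⟩

theorem QSummable.congr {ι R : Type*} [CommRing R] {e e' : ι → ℤ} {w w' : ι → R}
    (h : QSummable e w) (hw : ∀ i, w i = w' i) (he : ∀ i, e i = e' i) : QSummable e' w' := by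
  rwa [← funext hw, ← funext he]

theorem eq_zero_of_two_mul_eq_zero {f : ℤ⟦X⟧} (h : 2 * f = 0) : f = 0 := by
  ext n
  have := congrArg (coeff n) h
  rw [two_mul] at this
  simp only [map_add, map_zero] at this ⊢
  omega

/-- The weight of the ternary sum in the coordinates `(t, a, b)`. -/
def shearWeight (k : ℕ) (x : ℤ × ℤ × ℤ) : ℤ :=
  intSign x.1 * ((x.1 + x.2.2) ^ 2 - (x.1 - x.2.1) ^ 2) * (x.1 - x.2.1 + x.2.2) ^ k

/-- The ternary sum in the coordinates `(t, a, b)`, over a region `p`. -/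
noncomputable def shearSum (k : ℕ) (p : ℤ × ℤ × ℤ → Prop) [DecidablePred p] : ℤ⟦X⟧ :=
  qSum (fun x : ℤ × ℤ × ℤ => x.1 ^ 2 + 2 * (x.2.1 * x.2.2))
    fun x => if p x then shearWeight k x else 0

theorem qSummable_exchange (v : ℤ × ℤ × ℤ → ℤ) (hv : ∀ x, v x ≠ 0 → 1 ≤ x.2.1 ∧ 1 ≤ x.2.2) :
    QSummable (fun x : ℤ × ℤ × ℤ => x.1 ^ 2 + (x.2.1 ^ 2 + 2 * (x.2.1 * x.2.2))) v :=
  qSummable_theta_mul (qSummable_rankSeries fun _ => 1) _ fun x hx => by simpa using hv x hx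

/-- b may be negative here: in the coordinates (u, a, m) the exponent is u² + a² + 2am, so a ≥ 1 and
m = t - a + b ≥ 1 suffice. -/
theorem qSummable_shear (v : ℤ × ℤ × ℤ → ℤ)
    (hv : ∀ x, v x ≠ 0 → 1 ≤ x.2.1 ∧ 1 ≤ x.1 - x.2.1 + x.2.2) :
    QSummable (fun x : ℤ × ℤ × ℤ => x.1 ^ 2 + 2 * (x.2.1 * x.2.2)) v := by
  have h := (qSummable_exchange (fun x => v (shearEquiv.symm x)) fun x hx => by
    simpa [shearEquiv] using hv _ hx).equiv shearEquiv
  refine h.congr (fun x => by simp) fun x => ?_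
  simp only [shearEquiv, Equiv.coe_fn_mk]
  ring

/-- With r = a + m the exponent is u² + r² - m² and the weight is antisymmetric in u and r. The part
u > m of the region r > m ≥ 1 is stable under the exchange, so it contributes zero. On the rest, u ≤
m, the shear gives exponent t² + 2ab with b = m - u ≥ 0. -/
theorem heatSeries_eq_shearSum (k : ℕ) :
    heatSeries k = shearSum k fun x => 1 ≤ x.2.1 ∧ 0 ≤ x.2.2 ∧ 1 ≤ x.1 - x.2.1 + x.2.2 := by
  set e := fun x : ℤ × ℤ × ℤ => x.1 ^ 2 + (x.2.1 ^ 2 + 2 * (x.2.1 * x.2.2)) with he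
  set w := fun x : ℤ × ℤ × ℤ =>
    intSign (x.1 + x.2.1) * ((x.2.1 + x.2.2) ^ 2 - x.1 ^ 2) * x.2.2 ^ k with hw
  have h1 : heatSeries k =
      qSum e (fun x => if 1 ≤ x.2.1 ∧ 1 ≤ x.2.2 ∧ x.1 ≤ x.2.2 then w x else 0) +
      qSum e (fun x => if 1 ≤ x.2.1 ∧ 1 ≤ x.2.2 ∧ x.2.2 < x.1 then w x else 0) := by
    rw [heatSeries_eq_qSum, ← qSum_add]
    · refine qSum_congr (fun x => ?_) fun _ _ => rfl
      by_cases h1 : 1 ≤ x.2.1 <;> by_cases h2 : 1 ≤ x.2.2 <;> by_cases h3 : x.1 ≤ x.2.2 <;>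
        simp [h1, h2, h3, hw, not_lt.mpr, not_le.mp]
    all_goals
      refine qSummable_exchange _ fun x hx => ?_
      by_contra h
      exact hx (if_neg fun h' => h ⟨h'.1, h'.2.1⟩)
  have h2 : qSum e (fun x => if 1 ≤ x.2.1 ∧ 1 ≤ x.2.2 ∧ x.2.2 < x.1 then w x else 0) = 0 := by
    have hs : ∀ c : ℤ, QSummable e
        (fun x => c * if 1 ≤ x.2.1 ∧ 1 ≤ x.2.2 ∧ x.2.2 < x.1 then w x else 0) := fun c => by
      refine qSummable_exchange _ fun x hx => ?_
      by_contra h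
      exact right_ne_zero_of_mul hx (if_neg fun h' => h ⟨h'.1, h'.2.1⟩)
    -- One of the two copies is rewritten by the exchange, which turns it into the negative of the
    -- other.
    apply eq_zero_of_two_mul_eq_zero
    rw [two_mul]
    nth_rewrite 1 [← qSum_equiv exchangeEquiv]
    have h3 : qSum (fun i => e (exchangeEquiv i)) (fun x => if 1 ≤ (exchangeEquiv x).2.1 ∧
        1 ≤ (exchangeEquiv x).2.2 ∧ (exchangeEquiv x).2.2 < (exchangeEquiv x).1
        then w (exchangeEquiv x) else 0) =
        qSum e (fun x => (-1) * if 1 ≤ x.2.1 ∧ 1 ≤ x.2.2 ∧ x.2.2 < x.1 then w x else 0) := by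
      refine qSum_congr (fun x => ?_) fun x _ => ?_
      · simp only [exchangeEquiv, Equiv.coe_fn_mk]
        have : (1 ≤ x.1 - x.2.2 ∧ 1 ≤ x.2.2 ∧ x.2.2 < x.2.1 + x.2.2) ↔
            (1 ≤ x.2.1 ∧ 1 ≤ x.2.2 ∧ x.2.2 < x.1) := by omega
        simp only [this, hw]
        split_ifs
        · rw [show x.2.1 + x.2.2 + (x.1 - x.2.2) = x.1 + x.2.1 by ring]
          ring
        · simp
      · simp only [exchangeEquiv, Equiv.coe_fn_mk, he]
        ring
    have hs1 := hs 1
    simp only [one_mul] at hs1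
    rw [h3, ← qSum_add (hs (-1)) hs1, ← qSum_zero e]
    exact qSum_congr (fun x => by ring) fun _ _ => rfl
  rw [h1, h2, add_zero, ← qSum_equiv shearEquiv, shearSum]
  refine qSum_congr (fun x => ?_) fun x _ => ?_
  · simp only [shearEquiv, Equiv.coe_fn_mk, hw, shearWeight]
    have : (1 ≤ x.2.1 ∧ 1 ≤ x.1 - x.2.1 + x.2.2 ∧ x.1 - x.2.1 ≤ x.1 - x.2.1 + x.2.2) ↔
        (1 ≤ x.2.1 ∧ 0 ≤ x.2.2 ∧ 1 ≤ x.1 - x.2.1 + x.2.2) := by omega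
    simp only [this]
    split_ifs
    · rw [show x.1 - x.2.1 + x.2.1 = x.1 by ring]
      ring
    · rfl
  · simp only [shearEquiv, Equiv.coe_fn_mk, he]
    ring

theorem heatSeries_eq_add (k : ℕ) :
    heatSeries k =
      shearSum k (fun x => 1 ≤ x.2.1 ∧ 1 ≤ x.2.2 ∧ 1 ≤ x.1 - x.2.1 + x.2.2) +
      shearSum k (fun x => 1 ≤ x.2.1 ∧ x.2.2 = 0 ∧ 1 ≤ x.1 - x.2.1 + x.2.2) := by
  rw [heatSeries_eq_shearSum, shearSum, shearSum, shearSum, ← qSum_add]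
  · refine qSum_congr (fun x => ?_) fun _ _ => rfl
    split_ifs <;> first | (exfalso; omega) | simp
  all_goals
    refine qSummable_shear _ fun x hx => ?_
    by_contra h
    exact hx (if_neg fun h' => h ⟨h'.1, h'.2.2⟩)

/-- `reflectEquiv` negates both m = t - a + b and (t+b)² - (t-a)². For odd k the weight is therefore
invariant and the halves m > 0 and m < 0 agree, while m = 0 has weight zero. -/
theorem two_mul_shearSum_pos (k : ℕ) (hk : Odd k) :
    2 * shearSum k (fun x => 1 ≤ x.2.1 ∧ 1 ≤ x.2.2 ∧ 1 ≤ x.1 - x.2.1 + x.2.2) =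
      shearSum k (fun x => 1 ≤ x.2.1 ∧ 1 ≤ x.2.2) := by
  rw [two_mul]
  conv_lhs =>
    arg 2
    rw [shearSum, ← qSum_equiv reflectEquiv]
  have h : qSum (fun i => (reflectEquiv i).1 ^ 2 + 2 *
      ((reflectEquiv i).2.1 * (reflectEquiv i).2.2))
      (fun i => if 1 ≤ (reflectEquiv i).2.1 ∧ 1 ≤ (reflectEquiv i).2.2 ∧
        1 ≤ (reflectEquiv i).1 - (reflectEquiv i).2.1 + (reflectEquiv i).2.2
        then shearWeight k (reflectEquiv i) else 0) =
      shearSum k (fun x => 1 ≤ x.2.1 ∧ 1 ≤ x.2.2 ∧ 1 ≤ -(x.1 - x.2.1 + x.2.2)) := by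
    refine qSum_congr (fun x => ?_) fun x _ => ?_
    · simp only [reflectEquiv, Equiv.coe_fn_mk, shearWeight]
      have : (1 ≤ x.2.2 ∧ 1 ≤ x.2.1 ∧ 1 ≤ -x.1 - x.2.2 + x.2.1) ↔
        (1 ≤ x.2.1 ∧ 1 ≤ x.2.2 ∧ 1 ≤ -(x.1 - x.2.1 + x.2.2)) := by omega
      simp only [this]
      split_ifs
      · rw [intSign_neg, show -x.1 - x.2.2 + x.2.1 = -(x.1 - x.2.1 + x.2.2) by ring, hk.neg_pow]
        ring
      · rfl
    · simp only [reflectEquiv, Equiv.coe_fn_mk]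
      ring
  have hs : ∀ v : ℤ × ℤ × ℤ → ℤ, (∀ x, v x ≠ 0 → 1 ≤ x.2.1 ∧ 1 ≤ x.2.2) →
      QSummable (fun x : ℤ × ℤ × ℤ => x.1 ^ 2 + 2 * (x.2.1 * x.2.2)) v := fun v hv =>
    qSummable_theta_mul (qSummable_lambert (by norm_num) fun _ => 1) _ fun x hx => by
      simpa using hv x hx
  rw [h, shearSum, shearSum, shearSum, ← qSum_add]
  · refine qSum_congr (fun x => ?_) fun _ _ => rfl
    have : x.1 - x.2.1 + x.2.2 = 0 → shearWeight k x = 0 := fun h0 => by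
      rw [shearWeight, h0, zero_pow hk.pos.ne', mul_zero]
    split_ifs <;> first | (exfalso; omega) | (simp; done) | (rw [this (by omega)]; simp)
  all_goals
    refine hs _ fun x hx => ?_
    by_contra h
    exact hx (if_neg fun h' => h ⟨h'.1, h'.2.1⟩)

theorem thetaMoment_mul_lambert (j : ℕ) (p : ℤ × ℤ → ℤ) :
    thetaMoment j * lambert 2 p = qSum (fun x : ℤ × ℤ × ℤ => x.1 ^ 2 + 2 * (x.2.1 * x.2.2))
      fun x => if 1 ≤ x.2.1 ∧ 1 ≤ x.2.2 then intSign x.1 * x.1 ^ j * p x.2 else 0 := by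
  rw [thetaMoment, lambert, qSum_mul (qSummable_sq _) (qSummable_lambert (by norm_num) _)]
  exact qSum_congr (fun x => by split_ifs <;> simp) fun _ _ => rfl

theorem qSummable_theta_lambert (v : ℤ × ℤ × ℤ → ℤ) :
    QSummable (fun x : ℤ × ℤ × ℤ => x.1 ^ 2 + 2 * (x.2.1 * x.2.2))
      fun x => if 1 ≤ x.2.1 ∧ 1 ≤ x.2.2 then v x else 0 :=
  qSummable_theta_mul (qSummable_lambert (by norm_num) fun _ => 1) _ fun x hx => by
    have h : 1 ≤ x.2.1 ∧ 1 ≤ x.2.2 := by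
      by_contra h
      exact hx (if_neg h)
    simp [h]

/-- With δ = b - a, the weight is (a+b)(2t+δ)(t+δ) = (a+b)(2t² + 3tδ + δ²) up to sign. The sum
becomes theta moments times Lambert series, and the odd moment drops out. -/
theorem shearSum_one_full :
    shearSum 1 (fun x => 1 ≤ x.2.1 ∧ 1 ≤ x.2.2) =
      4 * qDeriv ℤ theta * sigmaSeries 1 2
        + theta * (2 * sigmaSeries 3 2 - qDeriv ℤ (sigmaSeries 1 2)) := by
  have h : shearSum 1 (fun x => 1 ≤ x.2.1 ∧ 1 ≤ x.2.2) =
      C 2 * (thetaMoment 2 * lambert 2 (fun x => x.1 + x.2)) +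
      C 3 * (thetaMoment 1 * lambert 2 (fun x => (x.1 + x.2) * (x.2 - x.1))) +
      thetaMoment 0 * lambert 2 (fun x => (x.1 + x.2) * (x.2 - x.1) ^ 2) := by
    simp only [thetaMoment_mul_lambert]
    rw [← qSum_const_mul (qSummable_theta_lambert _), ← qSum_const_mul (qSummable_theta_lambert _),
      ← qSum_add ((qSummable_theta_lambert _).mul_left _) ((qSummable_theta_lambert _).mul_left _),
      ← qSum_add (((qSummable_theta_lambert _).mul_left _).add
        ((qSummable_theta_lambert _).mul_left _)) (qSummable_theta_lambert _), shearSum]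
    refine qSum_congr (fun x => ?_) fun _ _ => rfl
    split_ifs
    · rw [shearWeight]; ring
    · ring
  rw [h, thetaMoment_odd 1 (by decide), lambert_linear_sum, lambert_cubic_sum, theta,
    qDeriv_thetaMoment, map_ofNat]
  ring

/-- As for k = 1, now with (2t+δ)(t+δ)³ = 2t⁴ + 7t³δ + 9t²δ² + 5tδ³ + δ⁴. -/
theorem shearSum_three_full :
    shearSum 3 (fun x => 1 ≤ x.2.1 ∧ 1 ≤ x.2.2) =
      4 * qDeriv ℤ (qDeriv ℤ theta) * sigmaSeries 1 2
        + 9 * qDeriv ℤ theta * (2 * sigmaSeries 3 2 - qDeriv ℤ (sigmaSeries 1 2))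
        + theta * (2 * sigmaSeries 5 2 - 3 * qDeriv ℤ (sigmaSeries 3 2)
          + qDeriv ℤ (qDeriv ℤ (sigmaSeries 1 2))) := by
  have h : shearSum 3 (fun x => 1 ≤ x.2.1 ∧ 1 ≤ x.2.2) =
      C 2 * (thetaMoment 4 * lambert 2 (fun x => x.1 + x.2)) +
      C 9 * (thetaMoment 2 * lambert 2 (fun x => (x.1 + x.2) * (x.2 - x.1) ^ 2)) +
      thetaMoment 0 * lambert 2 (fun x => (x.1 + x.2) * (x.2 - x.1) ^ 4) +
      C 7 * (thetaMoment 3 * lambert 2 (fun x => (x.1 + x.2) * (x.2 - x.1))) +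
      C 5 * (thetaMoment 1 * lambert 2 (fun x => (x.1 + x.2) * (x.2 - x.1) ^ 3)) := by
    simp only [thetaMoment_mul_lambert]
    have hs := fun v => qSummable_theta_lambert v
    have hc := fun (c : ℤ) v => (qSummable_theta_lambert v).mul_left fun _ => c
    rw [← qSum_const_mul (hs _), ← qSum_const_mul (hs _), ← qSum_const_mul (hs _),
      ← qSum_const_mul (hs _), ← qSum_add (hc _ _) (hc _ _),
      ← qSum_add ((hc _ _).add (hc _ _)) (hs _),
      ← qSum_add (((hc _ _).add (hc _ _)).add (hs _)) (hc _ _),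
      ← qSum_add ((((hc _ _).add (hc _ _)).add (hs _)).add (hc _ _)) (hc _ _), shearSum]
    refine qSum_congr (fun x => ?_) fun _ _ => rfl
    split_ifs
    · rw [shearWeight]; ring
    · ring
  rw [h, thetaMoment_odd 1 (by decide), thetaMoment_odd 3 (by decide), lambert_linear_sum,
    lambert_cubic_sum, lambert_quintic_sum, theta, qDeriv_thetaMoment, qDeriv_thetaMoment,
    map_ofNat, map_ofNat]
  ring

/-- On b = 0 the exponent is t², and the sum over 1 ≤ a < t is a polynomial for t ≥ 1 but zero for t
≤ 0. Averaging t with -t replaces it by an even polynomial on all of ℤ, at the cost of a factor 2; c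
clears the denominators of the power sums. -/
theorem shearSum_boundary (k : ℕ) (c : ℤ) (P : ℤ → ℤ)
    (hP : ∀ t : ℤ, 1 ≤ t → c * ∑ a ∈ Finset.Ico 1 t, (t ^ 2 - (t - a) ^ 2) * (t - a) ^ k = P t)
    (hodd : ∀ t, P (-t) = P t) (h0 : P 0 = 0) :
    C (2 * c) * shearSum k (fun x => 1 ≤ x.2.1 ∧ x.2.2 = 0 ∧ 1 ≤ x.1 - x.2.1 + x.2.2) =
      qSum (fun t : ℤ => t ^ 2) fun t => intSign t * P t := by
  set Q : ℤ → ℤ := fun t => ∑ a ∈ Finset.Ico 1 t, (t ^ 2 - (t - a) ^ 2) * (t - a) ^ k with hQ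
  have hQ0 : ∀ t : ℤ, t ≤ 0 → Q t = 0 := fun t ht => by
    simp only [hQ]
    rw [Finset.Ico_eq_empty (by omega), Finset.sum_empty]
  have hs : QSummable (fun x : ℤ × ℤ × ℤ => x.1 ^ 2 + 2 * (x.2.1 * x.2.2))
      (fun x => if 1 ≤ x.2.1 ∧ x.2.2 = 0 ∧ 1 ≤ x.1 - x.2.1 + x.2.2
        then shearWeight k x else 0) := by
    refine qSummable_shear _ fun x hx => ?_
    by_contra h
    exact hx (if_neg fun h' => h ⟨h'.1, h'.2.2⟩)
  have h1 : shearSum k (fun x => 1 ≤ x.2.1 ∧ x.2.2 = 0 ∧ 1 ≤ x.1 - x.2.1 + x.2.2) =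
      qSum (fun t : ℤ => t ^ 2) fun t => intSign t * Q t := by
    ext n
    have hmem : ∀ t : ℤ, t ^ 2 = n → t ∈ Finset.Icc (-n : ℤ) n := fun t ht => by
      rw [Finset.mem_Icc]
      constructor <;> nlinarith
    rw [shearSum, coeff_qSum_prod hs n (Finset.Icc (-n : ℤ) n),
      coeff_qSum_eq_sum n (Finset.Icc (-n : ℤ) n) fun t _ ht => hmem t ht]
    · refine Finset.sum_congr rfl fun t _ => ?_
      rw [coeff_qSum_eq_sum n (Finset.Ico 1 t ×ˢ {0})]
      · rw [Finset.sum_product]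
        simp only [Finset.sum_singleton, mul_zero, add_zero]
        split_ifs with ht
        · rw [hQ, Finset.mul_sum]
          refine Finset.sum_congr rfl fun a ha => ?_
          rw [Finset.mem_Ico] at ha
          rw [if_pos ⟨ha.1, trivial, by omega⟩, shearWeight]
          ring
        · simp
      · intro x hx _
        have h : 1 ≤ x.1 ∧ x.2 = 0 ∧ 1 ≤ t - x.1 + x.2 := by
          by_contra h
          exact hx (if_neg h)
        rw [Finset.mem_product, Finset.mem_Ico, Finset.mem_singleton]
        exact ⟨⟨h.1, by omega⟩, h.2.1⟩
    · intro x hx hx'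
      apply hmem
      have h : 1 ≤ x.2.1 ∧ x.2.2 = 0 ∧ 1 ≤ x.1 - x.2.1 + x.2.2 := by
        by_contra h
        exact hx (if_neg h)
      simpa [h.2.1] using hx'
  have h2 : qSum (fun t : ℤ => t ^ 2) (fun t => c * (intSign t * Q (-t))) =
      qSum (fun t : ℤ => t ^ 2) fun t => c * (intSign t * Q t) := by
    rw [← qSum_equiv (Equiv.neg ℤ) _ fun t => c * (intSign t * Q t)]
    exact qSum_congr (fun t => by simp [intSign_neg]) fun t _ => by simp
  rw [h1, show C (2 * c) = C c + C c by rw [two_mul, map_add], add_mul,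
    ← qSum_const_mul (qSummable_sq _)]
  nth_rewrite 2 [← h2]
  rw [← qSum_add (qSummable_sq _) (qSummable_sq _)]
  refine qSum_congr (fun t => ?_) fun _ _ => rfl
  rcases lt_trichotomy t 0 with ht | ht | ht
  · rw [hQ0 t ht.le, ← hodd, ← hP (-t) (by omega)]
    ring
  · rw [ht, h0]
    simp [hQ0]
  · rw [hQ0 (-t) (by omega), ← hP t (by omega)]
    ring

theorem mul_sum_Ico_eq (c : ℤ) (f : ℤ → ℤ) (G : ℤ → ℤ) (h0 : G 0 = 0)
    (h : ∀ n, G (n + 1) = G n + c * f (n + 1)) (n : ℕ) :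
    c * ∑ a ∈ Finset.Ico (1 : ℤ) (n + 1), f a = G n := by
  induction n with
  | zero => simp [h0]
  | succ n ih =>
    have : Finset.Ico (1 : ℤ) ((n + 1 : ℕ) + 1) =
        insert ((n : ℤ) + 1) (Finset.Ico 1 ((n : ℤ) + 1)) := by
      ext x
      simp only [Finset.mem_Ico, Finset.mem_insert]
      omega
    rw [this, Finset.sum_insert (by simp), mul_add, ih]
    push_cast
    rw [h]
    ring

/-- Reversal m = t - a turns the sum into a power sum over 1 ≤ m ≤ t - 1, with discrete
antiderivative G. -/
theorem mul_sum_Ico_reflect (c : ℤ) (k : ℕ) (t : ℤ) (ht : 1 ≤ t) (G : ℤ → ℤ) (h0 : G 0 = 0)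
    (h : ∀ n, G (n + 1) = G n + c * ((t ^ 2 - (n + 1) ^ 2) * (n + 1) ^ k)) :
    c * ∑ a ∈ Finset.Ico 1 t, (t ^ 2 - (t - a) ^ 2) * (t - a) ^ k = G (t - 1) := by
  obtain ⟨n, hn⟩ : ∃ n : ℕ, t = n + 1 := ⟨(t - 1).toNat, by omega⟩
  have h1 := mul_sum_Ico_eq c (fun m => (t ^ 2 - m ^ 2) * m ^ k) G h0 h n
  rw [← hn] at h1
  rw [show t - 1 = n by omega, ← h1]
  congr 1
  refine Finset.sum_nbij' (fun a => t - a) (fun a => t - a) ?_ ?_ ?_ ?_ ?_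
  · intro a ha; simp only [Finset.mem_Ico] at ha ⊢; omega
  · intro a ha; simp only [Finset.mem_Ico] at ha ⊢; omega
  · intro a _; ring
  · intro a _; ring
  · intro a _; rfl

theorem eight_mul_heatSeries_one :
    8 * heatSeries 1 = 16 * qDeriv ℤ theta * sigmaSeries 1 2 + 8 * theta * sigmaSeries 3 2
      - 4 * theta * qDeriv ℤ (sigmaSeries 1 2)
      + qDeriv ℤ (qDeriv ℤ theta) - qDeriv ℤ theta := by
  have h1 := two_mul_shearSum_pos 1 (by decide)
  rw [shearSum_one_full] at h1
  -- 4 ∑_{m≤n} (t² - m²)m = 2t²n(n+1) - n²(n+1)², which at n = t - 1 is t⁴ - t².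
  have h2 := shearSum_boundary 1 4 (fun t => t ^ 4 - t ^ 2) (fun t ht => by
    rw [mul_sum_Ico_reflect 4 1 t ht (fun n => 2 * t ^ 2 * n * (n + 1) - n ^ 2 * (n + 1) ^ 2)
      (by norm_num) fun n => by ring]
    ring) (fun t => by ring) (by norm_num)
  have h3 : qSum (fun t : ℤ => t ^ 2) (fun t => intSign t * (t ^ 4 - t ^ 2)) =
      qDeriv ℤ (qDeriv ℤ theta) - qDeriv ℤ theta := by
    rw [eq_sub_iff_add_eq, theta, qDeriv_thetaMoment, qDeriv_thetaMoment, thetaMoment,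
      ← qSum_add (qSummable_sq _) (qSummable_sq _)]
    exact qSum_congr (fun t => by ring) fun _ _ => rfl
  rw [h3, show (C (2 * 4) : ℤ⟦X⟧) = 8 by norm_num] at h2
  rw [heatSeries_eq_add]
  linear_combination 4 * h1 + h2

theorem twenty_four_mul_heatSeries_three :
    24 * heatSeries 3 = 48 * qDeriv ℤ (qDeriv ℤ theta) * sigmaSeries 1 2
      + 216 * qDeriv ℤ theta * sigmaSeries 3 2
      - 108 * qDeriv ℤ theta * qDeriv ℤ (sigmaSeries 1 2)
      + 24 * theta * sigmaSeries 5 2 - 36 * theta * qDeriv ℤ (sigmaSeries 3 2)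
      + 12 * theta * qDeriv ℤ (qDeriv ℤ (sigmaSeries 1 2))
      + qDeriv ℤ (qDeriv ℤ (qDeriv ℤ theta)) - 2 * qDeriv ℤ (qDeriv ℤ theta)
      + qDeriv ℤ theta := by
  have h1 := two_mul_shearSum_pos 3 (by decide)
  rw [shearSum_three_full] at h1
  -- 12 ∑_{m≤n} m³ = 3n²(n+1)² and 12 ∑_{m≤n} m⁵ = n²(n+1)²(2n²+2n-1); at n = t - 1 the combination
  -- is t²(t²-1)².
  have h2 := shearSum_boundary 3 12 (fun t => t ^ 6 - 2 * t ^ 4 + t ^ 2) (fun t ht => by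
    rw [mul_sum_Ico_reflect 12 3 t ht (fun n => 3 * t ^ 2 * (n ^ 2 * (n + 1) ^ 2)
      - n ^ 2 * (n + 1) ^ 2 * (2 * n ^ 2 + 2 * n - 1)) (by norm_num) fun n => by ring]
    ring) (fun t => by ring) (by norm_num)
  have h3 : qSum (fun t : ℤ => t ^ 2) (fun t => intSign t * (t ^ 6 - 2 * t ^ 4 + t ^ 2)) =
      qDeriv ℤ (qDeriv ℤ (qDeriv ℤ theta)) - 2 * qDeriv ℤ (qDeriv ℤ theta) + qDeriv ℤ theta := by
    rw [sub_eq_add_neg, ← neg_mul, show (-2 : ℤ⟦X⟧) = C (-2) by simp,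
      theta, qDeriv_thetaMoment, qDeriv_thetaMoment, qDeriv_thetaMoment, thetaMoment, thetaMoment,
      thetaMoment, ← qSum_const_mul (qSummable_sq _), ← qSum_add (qSummable_sq _) (qSummable_sq _),
      ← qSum_add (qSummable_sq _) (qSummable_sq _)]
    exact qSum_congr (fun t => by ring) fun _ _ => rfl
  rw [h3, show (C (2 * 12) : ℤ⟦X⟧) = 24 by norm_num] at h2
  rw [heatSeries_eq_add]
  linear_combination 12 * h1 + h2

/-! ### Liouville's method and Ramanujan's convolution identity -/

/-- Summation along the fibres of the first projection. -/
theorem qSum_fiber {ι κ R : Type*} [CommRing R] {e : ι × κ → ℤ} {w : ι × κ → R}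
    (h : QSummable e w) (e' : ι → ℤ) (he : ∀ p, w p ≠ 0 → e p = e' p.1) (K : ι → Finset κ)
    (hK : ∀ i k, w (i, k) ≠ 0 → k ∈ K i) :
    qSum e w = qSum e' fun i => ∑ k ∈ K i, w (i, k) := by
  classical
  ext n
  obtain ⟨s, hs⟩ := h.exists_finset n
  rw [coeff_qSum_prod h n (s.image Prod.fst) fun p hp hp' =>
      Finset.mem_image.mpr ⟨p, hs p hp hp'.le, rfl⟩, coeff_qSum_eq_sum n (s.image Prod.fst)]
  · refine Finset.sum_congr rfl fun i _ => ?_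
    rw [coeff_qSum_eq_sum n (K i) fun k hk _ => hK i k hk]
    have h1 : ∀ k ∈ K i, (if e (i, k) = n then w (i, k) else 0) =
        if e' i = n then w (i, k) else 0 := fun k _ => by
      by_cases h0 : w (i, k) = 0
      · simp [h0]
      · rw [he _ h0]
    rw [Finset.sum_congr rfl h1]
    split_ifs <;> simp
  · intro i hi hi'
    obtain ⟨k, _, hk⟩ := Finset.exists_ne_zero_of_sum_ne_zero hi
    exact Finset.mem_image.mpr ⟨(i, k), hs _ hk (by rw [he _ hk]; exact hi'.le), rfl⟩

/-- The series `∑ f q^(ax + by)` over the quadruples `((a, x), (b, y))` of positive integers in a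
region `p`. -/
noncomputable def quadSum (p : (ℤ × ℤ) × ℤ × ℤ → Prop) [DecidablePred p]
    (f : (ℤ × ℤ) × ℤ × ℤ → ℤ) : ℤ⟦X⟧ :=
  qSum (fun z : (ℤ × ℤ) × ℤ × ℤ => 1 * (z.1.1 * z.1.2) + 1 * (z.2.1 * z.2.2)) fun z =>
    if (1 ≤ z.1.1 ∧ 1 ≤ z.1.2 ∧ 1 ≤ z.2.1 ∧ 1 ≤ z.2.2) ∧ p z then f z else 0

theorem qSummable_quadSum (p : (ℤ × ℤ) × ℤ × ℤ → Prop) [DecidablePred p]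
    (f : (ℤ × ℤ) × ℤ × ℤ → ℤ) :
    QSummable (fun z : (ℤ × ℤ) × ℤ × ℤ => 1 * (z.1.1 * z.1.2) + 1 * (z.2.1 * z.2.2)) fun z =>
      if (1 ≤ z.1.1 ∧ 1 ≤ z.1.2 ∧ 1 ≤ z.2.1 ∧ 1 ≤ z.2.2) ∧ p z then f z else 0 := by
  refine ((qSummable_lambert le_rfl fun _ => 1).mul (qSummable_lambert le_rfl fun _ => 1)).mono
    fun z hz => ?_
  have h : (1 ≤ z.1.1 ∧ 1 ≤ z.1.2 ∧ 1 ≤ z.2.1 ∧ 1 ≤ z.2.2) ∧ p z := by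
    by_contra h
    exact hz (if_neg h)
  simp [h.1]

section

variable (p r : (ℤ × ℤ) × ℤ × ℤ → Prop) [DecidablePred p] [DecidablePred r]
  (f g : (ℤ × ℤ) × ℤ × ℤ → ℤ)

theorem quadSum_split : quadSum p f =
    quadSum (fun z => p z ∧ r z) f + quadSum (fun z => p z ∧ ¬ r z) f := by
  rw [quadSum, quadSum, quadSum, ← qSum_add (qSummable_quadSum _ _) (qSummable_quadSum _ _)]
  refine qSum_congr (fun z => ?_) fun _ _ => rfl
  by_cases h1 : p z <;> by_cases h2 : r z <;> simp [h1, h2]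

theorem quadSum_add : quadSum p (fun z => f z + g z) = quadSum p f + quadSum p g := by
  rw [quadSum, quadSum, quadSum, ← qSum_add (qSummable_quadSum _ _) (qSummable_quadSum _ _)]
  exact qSum_congr (fun z => by split_ifs <;> simp) fun _ _ => rfl

theorem quadSum_const_mul (c : ℤ) : quadSum p (fun z => c * f z) = C c * quadSum p f := by
  rw [quadSum, quadSum, ← qSum_const_mul (qSummable_quadSum _ _)]
  exact qSum_congr (fun z => by split_ifs <;> simp) fun _ _ => rfl

theorem quadSum_congr (hp : ∀ z, p z ↔ r z) (hf : ∀ z, p z → f z = g z) :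
    quadSum p f = quadSum r g := by
  rw [quadSum, quadSum]
  refine qSum_congr (fun z => ?_) fun _ _ => rfl
  by_cases h : p z
  · simp [h, (hp z).1 h, hf z h]
  · simp [h, mt (hp z).2 h]

theorem quadSum_swap : quadSum (fun z => p z.swap) (fun z => f z.swap) = quadSum p f := by
  rw [quadSum, quadSum, ← qSum_equiv (Equiv.prodComm (ℤ × ℤ) (ℤ × ℤ))]
  refine qSum_congr (fun z => ?_) fun z _ => ?_
  · simp only [Equiv.prodComm_apply, Prod.fst_swap, Prod.snd_swap]
    exact if_congr (by tauto) rfl rfl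
  · simp only [Equiv.prodComm_apply, Prod.fst_swap, Prod.snd_swap]
    ring

/-- The substitution `(a, x, b, y) ↦ (a, x - y, a + b, y)`. -/
def quadEquiv : (ℤ × ℤ) × ℤ × ℤ ≃ (ℤ × ℤ) × ℤ × ℤ where
  toFun z := ((z.1.1, z.1.2 - z.2.2), (z.1.1 + z.2.1, z.2.2))
  invFun z := ((z.1.1, z.1.2 + z.2.2), (z.2.1 - z.1.1, z.2.2))
  left_inv z := by ext <;> simp
  right_inv z := by ext <;> simp

/-- ax + by = a(x-y) + (a+b)y, so `quadEquiv` preserves the exponent and carries y < x to a < b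
among positive quadruples. -/
theorem quadSum_shift : quadSum (fun z => z.2.2 < z.1.2) (fun z => f (quadEquiv z)) =
    quadSum (fun z => z.1.1 < z.2.1) f := by
  rw [quadSum, quadSum]
  conv_rhs => rw [← qSum_equiv quadEquiv]
  refine qSum_congr (fun z => ?_) fun z _ => ?_
  · refine if_congr ?_ rfl rfl
    simp only [quadEquiv, Equiv.coe_fn_mk]
    omega
  · simp only [quadEquiv, Equiv.coe_fn_mk]
    ring

end

theorem quadSum_split_trichotomy (u v : (ℤ × ℤ) × ℤ × ℤ → ℤ) (f : (ℤ × ℤ) × ℤ × ℤ → ℤ) :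
    quadSum (fun _ => True) f = quadSum (fun z => u z < v z) f + quadSum (fun z => v z < u z) f +
      quadSum (fun z => u z = v z) f := by
  rw [quadSum_split _ (fun z => u z < v z),
    quadSum_split (fun z => True ∧ ¬ (u z < v z)) (fun z => v z < u z), add_assoc]
  congr 1
  · exact quadSum_congr _ _ _ _ (fun z => by simp) fun _ _ => rfl
  congr 1
  · exact quadSum_congr _ _ _ _ (fun z => by simp only [true_and, not_lt]; omega) fun _ _ => rfl
  · exact quadSum_congr _ _ _ _ (fun z => by simp only [true_and, not_lt]; omega) fun _ _ => rfl

/-- Liouville's elementary evaluation of a convolution of divisor sums. -/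
theorem four_mul_sigmaSeries_sq :
    4 * sigmaSeries 1 1 ^ 2 = quadSum (fun z => z.1.2 = z.2.2) (fun z => (z.1.1 + z.2.1) ^ 2)
      + 2 * quadSum (fun z => z.1.2 = z.2.2) (fun z => z.2.1 ^ 2)
      - 2 * quadSum (fun z => z.1.1 = z.2.1) (fun z => z.2.1 ^ 2) := by
  have h0 : sigmaSeries 1 1 ^ 2 = quadSum (fun _ => True) fun z => z.1.1 * z.2.1 := by
    rw [sq, sigmaSeries, lambert, qSum_mul (qSummable_lambert le_rfl _)
      (qSummable_lambert le_rfl _), quadSum]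
    refine qSum_congr (fun z => ?_) fun _ _ => rfl
    by_cases h1 : 1 ≤ z.1.1 ∧ 1 ≤ z.1.2
    · by_cases h2 : 1 ≤ z.2.1 ∧ 1 ≤ z.2.2
      · simp [h1, h2]
      · rw [if_neg h2, mul_zero, if_neg fun h => h2 ⟨h.1.2.2.1, h.1.2.2.2⟩]
    · rw [if_neg h1, zero_mul, if_neg fun h => h1 ⟨h.1.1, h.1.2.1⟩]
  -- 4ab = (a+b)² - (a-b)². The first square is split by comparing x with y, the second by comparing
  -- a with b. Swap and shift turn the off-diagonal parts into twice the sums of b² over a < b and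
  -- over y < x. The difference of these two sums is diagonal, by splitting the full sum of b² both
  -- ways and using `e6`.
  have h1 : quadSum (fun _ => True) (fun z => (z.1.1 + z.2.1) ^ 2) =
      quadSum (fun _ => True) (fun z => (z.1.1 - z.2.1) ^ 2) + 4 * sigmaSeries 1 1 ^ 2 := by
    rw [h0, show (4 : ℤ⟦X⟧) = C 4 from (map_ofNat _ 4).symm, ← quadSum_const_mul, ← quadSum_add]
    exact quadSum_congr _ _ _ _ (fun _ => Iff.rfl) fun z _ => by ring
  have h2 := quadSum_split_trichotomy (fun z => z.1.2) (fun z => z.2.2)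
    fun z => (z.1.1 + z.2.1) ^ 2
  have h3 := quadSum_split_trichotomy (fun z => z.1.1) (fun z => z.2.1)
    fun z => (z.1.1 - z.2.1) ^ 2
  have h4 := quadSum_split_trichotomy (fun z => z.1.2) (fun z => z.2.2) fun z => z.2.1 ^ 2
  have h5 := quadSum_split_trichotomy (fun z => z.1.1) (fun z => z.2.1) fun z => z.2.1 ^ 2
  have e1 : quadSum (fun z => z.1.2 < z.2.2) (fun z => (z.1.1 + z.2.1) ^ 2) =
      quadSum (fun z => z.2.2 < z.1.2) (fun z => (z.1.1 + z.2.1) ^ 2) := by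
    rw [← quadSum_swap]
    exact quadSum_congr _ _ _ _ (fun _ => Iff.rfl) fun z _ => by
      simp only [Prod.fst_swap, Prod.snd_swap]; ring
  have e2 : quadSum (fun z => z.2.1 < z.1.1) (fun z => (z.1.1 - z.2.1) ^ 2) =
      quadSum (fun z => z.1.1 < z.2.1) (fun z => (z.1.1 - z.2.1) ^ 2) := by
    rw [← quadSum_swap]
    exact quadSum_congr _ _ _ _ (fun _ => Iff.rfl) fun z _ => by
      simp only [Prod.fst_swap, Prod.snd_swap]; ring
  have e3 : quadSum (fun z => z.2.2 < z.1.2) (fun z => (z.1.1 + z.2.1) ^ 2) =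
      quadSum (fun z => z.1.1 < z.2.1) (fun z => z.2.1 ^ 2) := quadSum_shift fun z => z.2.1 ^ 2
  have e4 : quadSum (fun z => z.1.1 < z.2.1) (fun z => (z.1.1 - z.2.1) ^ 2) =
      quadSum (fun z => z.2.2 < z.1.2) (fun z => z.2.1 ^ 2) := by
    rw [← quadSum_shift]
    exact quadSum_congr _ _ _ _ (fun _ => Iff.rfl) fun z _ => by
      simp only [quadEquiv, Equiv.coe_fn_mk]; ring
  have e5 : quadSum (fun z => z.1.1 = z.2.1) (fun z => (z.1.1 - z.2.1) ^ 2) = 0 := by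
    rw [quadSum, ← qSum_zero fun z : (ℤ × ℤ) × ℤ × ℤ => 1 * (z.1.1 * z.1.2) + 1 * (z.2.1 * z.2.2)]
    refine qSum_congr (fun z => ?_) fun _ _ => rfl
    split_ifs with h
    · rw [h.2]; ring
    · rfl
  have e6 : quadSum (fun z => z.1.2 < z.2.2) (fun z => z.2.1 ^ 2) =
      quadSum (fun z => z.2.1 < z.1.1) (fun z => z.2.1 ^ 2) := by
    rw [← quadSum_swap, ← quadSum_swap (fun z => z.2.1 < z.1.1)]
    exact quadSum_shift fun z => z.1.1 ^ 2
  linear_combination -h1 + h2 - h3 + e1 + 2 * e3 - e2 - 2 * e4 - e5 + 2 * (h4 - h5) + 2 * e6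

/-- On the diagonal a = b the exponent is a(x+y), so the quadruples are grouped by a and x + y. -/
theorem quadSum_eq_lambert (f : ℤ → ℤ → ℤ → ℤ) :
    quadSum (fun z => z.1.1 = z.2.1) (fun z => f z.1.1 (z.1.2 + z.2.2) z.2.2) =
      lambert 1 fun x => ∑ y ∈ Finset.Ico 1 x.2, f x.1 x.2 y := by
  let σ : (ℤ × ℤ) × ℤ × ℤ ≃ (ℤ × ℤ) × ℤ × ℤ :=
    { toFun := fun z => ((z.1.1, z.1.2 - z.2.2), z.2)
      invFun := fun z => ((z.1.1, z.1.2 + z.2.2), z.2)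
      left_inv := fun z => by ext <;> simp
      right_inv := fun z => by ext <;> simp }
  have hs := (qSummable_quadSum (fun z => z.1.1 = z.2.1)
    (fun z => f z.1.1 (z.1.2 + z.2.2) z.2.2)).equiv σ
  have hne : ∀ z, (if (1 ≤ (σ z).1.1 ∧ 1 ≤ (σ z).1.2 ∧ 1 ≤ (σ z).2.1 ∧ 1 ≤ (σ z).2.2) ∧
      (σ z).1.1 = (σ z).2.1 then f (σ z).1.1 ((σ z).1.2 + (σ z).2.2) (σ z).2.2 else 0) ≠ 0 →
      1 ≤ z.1.1 ∧ z.2.2 < z.1.2 ∧ 1 ≤ z.2.2 ∧ z.1.1 = z.2.1 := fun z hz => by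
    have h := by_contra fun h => hz (if_neg h)
    simp only [σ, Equiv.coe_fn_mk] at h
    omega
  rw [quadSum, ← qSum_equiv σ, qSum_fiber hs (fun x => 1 * (x.1 * x.2)) (fun z hz => ?_)
    (fun x => {x.1} ×ˢ Finset.Ico 1 x.2) (fun x y hy => ?_), lambert]
  · refine qSum_congr (fun x => ?_) fun _ _ => rfl
    simp only [Finset.sum_product, Finset.sum_singleton]
    by_cases hx : 1 ≤ x.1 ∧ 1 ≤ x.2
    · rw [if_pos hx]
      refine Finset.sum_congr rfl fun y hy => ?_
      rw [Finset.mem_Ico] at hy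
      refine (if_pos
        (show (1 ≤ x.1 ∧ 1 ≤ x.2 - y ∧ 1 ≤ x.1 ∧ 1 ≤ y) ∧ x.1 = x.1 by omega)).trans ?_
      simp only [σ, Equiv.coe_fn_mk, sub_add_cancel]
    · rw [if_neg hx]
      refine Finset.sum_eq_zero fun y hy => if_neg ?_
      rw [Finset.mem_Ico] at hy
      show ¬ ((1 ≤ x.1 ∧ 1 ≤ x.2 - y ∧ 1 ≤ x.1 ∧ 1 ≤ y) ∧ x.1 = x.1)
      omega
  · have := hne z hz
    simp only [σ, Equiv.coe_fn_mk, ← this.2.2.2]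
    ring
  · have : 1 ≤ x.1 ∧ y.2 < x.2 ∧ 1 ≤ y.2 ∧ x.1 = y.1 := hne (x, y) hy
    simp only [Finset.mem_product, Finset.mem_singleton, Finset.mem_Ico]
    omega

theorem quadSum_transpose (f : (ℤ × ℤ) × ℤ × ℤ → ℤ) :
    quadSum (fun z => z.1.2 = z.2.2) f =
      quadSum (fun z => z.1.1 = z.2.1) fun z => f (z.1.swap, z.2.swap) := by
  rw [quadSum, quadSum, ← qSum_equiv ((Equiv.prodComm ℤ ℤ).prodCongr (Equiv.prodComm ℤ ℤ))]
  refine qSum_congr (fun z => ?_) fun z _ => ?_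
  · simp only [Equiv.prodCongr_apply, Prod.map, Equiv.prodComm_apply, Prod.fst_swap, Prod.snd_swap]
    exact if_congr (by tauto) rfl rfl
  · simp only [Equiv.prodCongr_apply, Prod.map, Equiv.prodComm_apply, Prod.fst_swap, Prod.snd_swap]
    ring

theorem lambert_congr {d : ℤ} {p r : ℤ × ℤ → ℤ} (h : ∀ x : ℤ × ℤ, 1 ≤ x.2 → p x = r x) :
    lambert d p = lambert d r := by
  refine qSum_congr (fun x => ?_) fun _ _ => rfl
  split_ifs with hx
  · exact h x hx.2
  · rfl

/-- Ramanujan's convolution identity for the divisor function. -/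
theorem twelve_mul_sigmaSeries_sq :
    12 * sigmaSeries 1 1 ^ 2 =
      5 * sigmaSeries 3 1 + sigmaSeries 1 1 - 6 * qDeriv ℤ (sigmaSeries 1 1) := by
  have hd : (1 : ℤ) ≤ 1 := le_rfl
  have hsum : ∀ (c : ℤ) (f G : ℤ → ℤ), G 0 = 0 → (∀ n, G (n + 1) = G n + c * f (n + 1)) →
      C c * lambert 1 (fun x => ∑ y ∈ Finset.Ico 1 x.2, f y) = lambert 1 fun x => G (x.2 - 1) := by
    intro c f G h0 h
    rw [← lambert_const_mul hd]
    refine lambert_congr fun x hx => ?_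
    obtain ⟨n, hn⟩ : ∃ n : ℕ, x.2 = n + 1 := ⟨(x.2 - 1).toNat, by omega⟩
    rw [hn, mul_sum_Ico_eq c f G h0 h n, add_sub_cancel_right]
  have h1 : quadSum (fun z => z.1.1 = z.2.1) (fun z => z.2.1 ^ 2) =
      lambert 1 fun x => x.1 ^ 2 * (x.2 - 1) := by
    rw [quadSum_congr _ (fun z => z.1.1 = z.2.1) _ (fun z => z.1.1 ^ 2) (fun _ => Iff.rfl)
      fun z hz => by rw [hz], quadSum_eq_lambert fun a _ _ => a ^ 2]
    refine lambert_congr fun x hx => ?_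
    rw [Finset.sum_const, Int.card_Ico, nsmul_eq_mul, Int.toNat_of_nonneg (by omega), mul_comm]
  have h2 : 6 * quadSum (fun z => z.1.2 = z.2.2) (fun z => z.2.1 ^ 2) =
      lambert 1 fun x => (x.2 - 1) * x.2 * (2 * x.2 - 1) := by
    rw [quadSum_transpose, show (6 : ℤ⟦X⟧) = C 6 from (map_ofNat _ 6).symm]
    refine (congrArg _ (quadSum_eq_lambert fun _ _ y => y ^ 2)).trans ?_
    rw [hsum 6 (fun y => y ^ 2) (fun n => n * (n + 1) * (2 * n + 1)) (by norm_num) fun n => by ring]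
    exact lambert_congr fun x _ => by ring
  have h3 : quadSum (fun z => z.1.2 = z.2.2) (fun z => (z.1.1 + z.2.1) ^ 2) =
      lambert 1 fun x => x.2 ^ 2 * (x.2 - 1) := by
    rw [quadSum_transpose]
    refine (quadSum_eq_lambert fun _ n _ => n ^ 2).trans (lambert_congr fun x hx => ?_)
    rw [Finset.sum_const, Int.card_Ico, nsmul_eq_mul, Int.toNat_of_nonneg (by omega), mul_comm]
  have hC : ∀ (n : ℕ) [n.AtLeastTwo], (OfNat.ofNat n : ℤ⟦X⟧) = C (OfNat.ofNat n) :=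
    fun n _ => (map_ofNat _ n).symm
  have h4 : 3 * lambert 1 (fun x => x.2 ^ 2 * (x.2 - 1)) +
      lambert 1 (fun x => (x.2 - 1) * x.2 * (2 * x.2 - 1)) + 6 * lambert 1 (fun x => x.1 ^ 2) =
      5 * sigmaSeries 3 1 + sigmaSeries 1 1 := by
    rw [← lambert_swap 1 fun x => x.1 ^ 2, sigmaSeries, sigmaSeries,
      ← lambert_swap 1 fun x => x.1 ^ 3, ← lambert_swap 1 fun x => x.1 ^ 1,
      hC 3, hC 6, hC 5, ← lambert_const_mul hd, ← lambert_const_mul hd, ← lambert_const_mul hd,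
      ← lambert_add hd, ← lambert_add hd, ← lambert_add hd]
    exact lambert_congr fun x _ => by simp only [Prod.fst_swap]; ring
  have h5 : lambert 1 (fun x => x.1 ^ 2 * (x.2 - 1)) + lambert 1 (fun x => x.1 ^ 2) =
      qDeriv ℤ (sigmaSeries 1 1) := by
    rw [sigmaSeries, qDeriv_lambert hd, map_one, one_mul, ← lambert_add hd]
    exact lambert_congr fun x _ => by ring
  have h6 := four_mul_sigmaSeries_sq
  rw [h1, h3] at h6
  linear_combination 3 * h6 + h2 + h4 - 6 * h5

/-! ### Finite Bailey pairs -/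

section FiniteBailey

variable {L : Type*} [Field L]

/-- The finite product `(1 - q) (1 - q^2) ⋯ (1 - q^n)`. -/
def qPoch {A : Type*} [CommRing A] (q : A) (n : ℕ) : A := ∏ i ∈ Finset.range n, (1 - q ^ (i + 1))

/-- The finite product `(1 + q) (1 + q^2) ⋯ (1 + q^n)`. -/
def qPochPlus {A : Type*} [CommRing A] (q : A) (n : ℕ) : A :=
  ∏ i ∈ Finset.range n, (1 + q ^ (i + 1))

theorem qPoch_succ {A : Type*} [CommRing A] (q : A) (n : ℕ) :
    qPoch q (n + 1) = qPoch q n * (1 - q ^ (n + 1)) := Finset.prod_range_succ _ _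

theorem qPochPlus_succ {A : Type*} [CommRing A] (q : A) (n : ℕ) :
    qPochPlus q (n + 1) = qPochPlus q n * (1 + q ^ (n + 1)) := Finset.prod_range_succ _ _

/-- The reciprocal of `qPoch q k`, extended by zero to negative `k`. -/
noncomputable def qInv (q : L) (k : ℤ) : L := if k < 0 then 0 else (qPoch q k.toNat)⁻¹

theorem qInv_natCast (q : L) (n : ℕ) : qInv q n = (qPoch q n)⁻¹ := by simp [qInv]

theorem qInv_of_neg (q : L) {k : ℤ} (hk : k < 0) : qInv q k = 0 := if_pos hk

theorem qPoch_ne_zero {q : L} (hq : ∀ n : ℕ, q ^ (n + 1) ≠ 1) (n : ℕ) : qPoch q n ≠ 0 :=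
  Finset.prod_ne_zero_iff.mpr fun i _ => sub_ne_zero.mpr (hq i).symm

/-- The extension by zero keeps this valid for k ≤ 0 (at k = 0 because 1 - q^0 = 0), so the
recurrences below have no boundary cases. -/
theorem qInv_pred {q : L} (hq : ∀ n : ℕ, q ^ (n + 1) ≠ 1) (k : ℤ) :
    qInv q (k - 1) = (1 - q ^ k) * qInv q k := by
  rcases lt_trichotomy k 0 with hk | rfl | hk
  · rw [qInv_of_neg q hk, qInv_of_neg q (by omega), mul_zero]
  · rw [qInv_of_neg q (by omega), zpow_zero, sub_self, zero_mul]
  · obtain ⟨n, rfl⟩ : ∃ n : ℕ, k = (n + 1 : ℕ) := ⟨(k - 1).toNat, by omega⟩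
    rw [show ((n + 1 : ℕ) : ℤ) - 1 = n by push_cast; ring, qInv_natCast, qInv_natCast, qPoch_succ,
      zpow_natCast]
    have h1 := qPoch_ne_zero hq n
    have h2 : (1 : L) - q ^ (n + 1) ≠ 0 := sub_ne_zero.mpr (hq n).symm
    field_simp

theorem qInv_neg_mul_self (q : L) {r : ℤ} (hr : r ≠ 0) : qInv q (-r) * qInv q r = 0 := by
  rcases lt_or_gt_of_ne hr with h | h
  · rw [qInv_of_neg q h, mul_zero]
  · rw [qInv_of_neg q (show -r < 0 by omega), zero_mul]

theorem sum_Icc_neg {A : Type*} [AddCommMonoid A] (N : ℕ) (f : ℤ → A) :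
    ∑ r ∈ Finset.Icc (-N : ℤ) N, f (-r) = ∑ r ∈ Finset.Icc (-N : ℤ) N, f r := by
  refine Finset.sum_nbij' (fun r => -r) (fun r => -r) ?_ ?_ ?_ ?_ ?_
  · intro a ha; simp only [Finset.mem_Icc] at ha ⊢; omega
  · intro a ha; simp only [Finset.mem_Icc] at ha ⊢; omega
  · intro a _; ring
  · intro a _; ring
  · intro a _; rfl

/-- r ↦ -1 - r preserves the half-open interval [-N, N) only, hence the separate condition at r = N.
-/
theorem sum_Icc_eq_zero_of_antisymm {A : Type*} [AddCommGroup A] (N : ℕ) (f : ℤ → A)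
    (h : ∀ r, f (-1 - r) = - f r) (hN : f N = 0) : ∑ r ∈ Finset.Icc (-N : ℤ) N, f r = 0 := by
  have h1 : ∑ r ∈ Finset.Ico (-N : ℤ) N, f r = ∑ r ∈ Finset.Icc (-N : ℤ) N, f r := by
    refine Finset.sum_subset Finset.Ico_subset_Icc_self fun r hr hr' => ?_
    simp only [Finset.mem_Icc, Finset.mem_Ico] at hr hr'
    rw [show r = N by omega, hN]
  rw [← h1]
  refine Finset.sum_involution (fun r _ => -1 - r) (fun r _ => by rw [h, add_neg_cancel])
    (fun r _ _ => by omega) (fun r hr => ?_) (fun r _ => by ring)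
  simp only [Finset.mem_Ico] at hr ⊢
  omega

theorem intSign_cast_neg_one_sub (r : ℤ) : ((intSign (-1 - r) : ℤ) : L) = -(intSign r : L) := by
  rw [show -1 - r = -(r + 1) by ring, intSign_neg, intSign_add]
  simp [intSign]

/-- The bilateral sum `∑ A r / ((q)_(n-r) (q)_(n+r))`. -/
noncomputable def baileySum (q : L) (N : ℕ) (A : ℤ → L) (n : ℕ) : L :=
  ∑ r ∈ Finset.Icc (-N : ℤ) N, A r * (qInv q (n - r) * qInv q (n + r))

theorem baileySum_zero (q : L) (N : ℕ) (A : ℤ → L) : baileySum q N A 0 = A 0 := by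
  rw [baileySum, Finset.sum_eq_single 0]
  · simp [qInv, qPoch]
  · intro r _ hr
    rw [Nat.cast_zero, zero_sub, zero_add, qInv_neg_mul_self q hr, mul_zero]
  · intro h
    simp at h

/-- Writes level n over the kernel of level n + 1, so that consecutive levels can be compared term
by term. -/
theorem baileySum_eq_of_pred {q : L} (hq : ∀ n : ℕ, q ^ (n + 1) ≠ 1) (N : ℕ) (A : ℤ → L) (n : ℕ) :
    baileySum q N A n = ∑ r ∈ Finset.Icc (-N : ℤ) N, A r *
      ((1 - q ^ ((n + 1 : ℕ) - r : ℤ)) * (1 - q ^ ((n + 1 : ℕ) + r : ℤ)) *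
        (qInv q ((n + 1 : ℕ) - r) * qInv q ((n + 1 : ℕ) + r))) := by
  refine Finset.sum_congr rfl fun r _ => ?_
  rw [show ((n : ℕ) : ℤ) - r = ((n + 1 : ℕ) - r) - 1 by push_cast; ring,
    show ((n : ℕ) : ℤ) + r = ((n + 1 : ℕ) + r) - 1 by push_cast; ring, qInv_pred hq, qInv_pred hq]
  ring

/-- A weight symmetric up to sign about `-1/2` annihilates the shifted kernel. -/
theorem sum_shifted_kernel_eq_zero {q : L} (hq : ∀ n : ℕ, q ^ (n + 1) ≠ 1) (N : ℕ) (A : ℤ → L)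
    (hA : ∀ r, A (-1 - r) = -A r) (n : ℕ) (hn : n ≤ N) :
    ∑ r ∈ Finset.Icc (-N : ℤ) N,
      A r * ((1 - q ^ (n - r : ℤ)) * (qInv q (n - r) * qInv q (n + r))) = 0 := by
  have h : ∀ r : ℤ, A r * ((1 - q ^ (n - r : ℤ)) * (qInv q (n - r) * qInv q (n + r))) =
      A r * (qInv q (n - r - 1) * qInv q (n + r)) := fun r => by
    rw [qInv_pred hq]; ring
  rw [Finset.sum_congr rfl fun r _ => h r]
  refine sum_Icc_eq_zero_of_antisymm N _ (fun r => ?_) ?_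
  · rw [hA, show (n : ℤ) - (-1 - r) - 1 = n + r by ring,
      show (n : ℤ) + (-1 - r) = n - r - 1 by ring]
    ring
  · rw [qInv_of_neg q (show (n : ℤ) - N - 1 < 0 by omega)]
    ring

theorem baileySum_gauss {q : L} (hq0 : q ≠ 0) (hq : ∀ n : ℕ, q ^ (n + 1) ≠ 1) (N n : ℕ)
    (hn : n ≤ N) :
    baileySum q N (fun r => intSign r * q ^ (r ^ 2)) n * (qPoch q n * qPochPlus q n) = 1 := by
  induction n with
  | zero => rw [baileySum_zero]; simp [qPoch, qPochPlus, intSign]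
  | succ n ih =>
    set b := baileySum q N (fun r => (intSign r : L) * q ^ (r ^ 2)) with hb
    have hz : ∑ r ∈ Finset.Icc (-N : ℤ) N, ((intSign r : L) * q ^ (r ^ 2)) *
        (q ^ ((n + 1 : ℕ) + r : ℤ) * (1 - q ^ ((n + 1 : ℕ) - r : ℤ)) *
          (qInv q ((n + 1 : ℕ) - r) * qInv q ((n + 1 : ℕ) + r))) = 0 := by
      rw [← sum_shifted_kernel_eq_zero hq N
        (fun r => (intSign r : L) * (q ^ (r ^ 2) * q ^ ((n + 1 : ℕ) + r : ℤ))) (fun r => ?_)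
        (n + 1) hn]
      · exact Finset.sum_congr rfl fun r _ => by ring
      · rw [intSign_cast_neg_one_sub, ← zpow_add₀ hq0, ← zpow_add₀ hq0,
          show (-1 - r) ^ 2 + ((n + 1 : ℕ) + (-1 - r) : ℤ) = r ^ 2 + ((n + 1 : ℕ) + r) by ring]
        ring
    have hz' := hz
    rw [← sum_Icc_neg] at hz'
    -- With A = q^(n+1-r) and B = q^(n+1+r), (1-AB) - (1-A)(1-B) = B(1-A) + A(1-B). The two pieces
    -- are the vanishing sum `hz` and its image under r ↦ -r.
    have hrec : b (n + 1) * (1 - q ^ (n + 1) * q ^ (n + 1)) = b n := by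
      rw [hb, baileySum_eq_of_pred hq N _ n, baileySum, Finset.sum_mul, ← sub_eq_zero,
        ← Finset.sum_sub_distrib, ← add_zero (0 : L)]
      nth_rewrite 2 [← hz]
      rw [← hz', ← Finset.sum_add_distrib]
      refine Finset.sum_congr rfl fun r _ => ?_
      have h1 : q ^ (n + 1) * q ^ (n + 1) =
          q ^ ((n + 1 : ℕ) - r : ℤ) * q ^ ((n + 1 : ℕ) + r : ℤ) := by
        rw [← zpow_add₀ hq0, ← zpow_natCast, ← zpow_add₀ hq0]
        congr 1
        ring
      rw [h1, intSign_neg, neg_sq, sub_neg_eq_add, ← sub_eq_add_neg]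
      ring
    have ih' := ih (by omega)
    rw [← hrec] at ih'
    rw [qPoch_succ, qPochPlus_succ]
    linear_combination ih'

theorem baileySum_jacobi {p : L} (hp0 : p ≠ 0) (hp : ∀ n : ℕ, (p ^ 2) ^ (n + 1) ≠ 1) (N n : ℕ)
    (hn : n ≤ N) :
    baileySum (p ^ 2) N (fun r => intSign r * p ^ (r ^ 2)) n *
      (qPoch (p ^ 2) n * qPochPlus p (2 * n)) * qPoch (p ^ 2) n = qPoch p (2 * n) := by
  induction n with
  | zero => rw [baileySum_zero]; simp [qPoch, qPochPlus, intSign]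
  | succ n ih =>
    have hp2 : p ^ 2 ≠ 0 := pow_ne_zero 2 hp0
    set b := baileySum (p ^ 2) N (fun r => (intSign r : L) * p ^ (r ^ 2)) with hb
    have hz : ∑ r ∈ Finset.Icc (-N : ℤ) N, ((intSign r : L) * (p ^ (r ^ 2) + p ^ (r + 1) ^ 2)) *
        ((1 - (p ^ 2) ^ ((n + 1 : ℕ) - r : ℤ)) *
          (qInv (p ^ 2) ((n + 1 : ℕ) - r) * qInv (p ^ 2) ((n + 1 : ℕ) + r))) = 0 :=
      sum_shifted_kernel_eq_zero hp N _ (fun r => by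
        rw [intSign_cast_neg_one_sub, show (-1 - r) ^ 2 = (r + 1) ^ 2 by ring,
          show (-1 - r + 1) ^ 2 = r ^ 2 by ring]; ring) _ hn
    have hz' := hz
    rw [← sum_Icc_neg] at hz'
    -- Same comparison, with p^(2n+1) times the vanishing sum and its reflection; the weight p^(r²)
    -- + p^((r+1)²) is symmetric about -1/2.
    have hrec : b (n + 1) * ((1 - p ^ 2 * (p ^ (2 * n + 1)) ^ 2) * (1 + p ^ (2 * n + 1))) =
        b n * (1 - p ^ (2 * n + 1)) := by
      rw [hb, baileySum_eq_of_pred hp N _ n, baileySum, Finset.sum_mul, Finset.sum_mul,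
        ← sub_eq_zero, ← Finset.sum_sub_distrib, ← mul_zero (p ^ (2 * n + 1)),
        ← add_zero (0 : L)]
      nth_rewrite 2 [← hz]
      rw [← hz', ← Finset.sum_add_distrib, Finset.mul_sum]
      refine Finset.sum_congr rfl fun r _ => ?_
      have h1 : (p ^ 2) ^ ((n + 1 : ℕ) - r : ℤ) = p * p ^ (2 * n + 1) * (p ^ 2) ^ (-r) := by
        rw [sub_eq_add_neg, zpow_add₀ hp2, zpow_natCast]
        ring
      have h2 : (p ^ 2) ^ ((n + 1 : ℕ) + r : ℤ) = p * p ^ (2 * n + 1) * (p ^ 2) ^ r := by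
        rw [zpow_add₀ hp2, zpow_natCast]
        ring
      have h3 : ∀ r : ℤ, p ^ (r + 1) ^ 2 = p ^ r ^ 2 * p * (p ^ 2) ^ r := fun r => by
        rw [← zpow_natCast, ← zpow_mul, ← zpow_add_one₀ hp0, ← zpow_add₀ hp0]
        congr 1
        push_cast
        ring
      have h4 : (p ^ 2) ^ r * (p ^ 2) ^ (-r) = 1 := by
        rw [← zpow_add₀ hp2, add_neg_cancel, zpow_zero]
      rw [h3, h3, intSign_neg, neg_sq, sub_neg_eq_add, ← sub_eq_add_neg, h1, h2]
      linear_combination ((intSign r : L) * p ^ r ^ 2 * (qInv (p ^ 2) ((n + 1 : ℕ) - r) *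
        qInv (p ^ 2) ((n + 1 : ℕ) + r)) * p ^ 2 * (p ^ (2 * n + 1)) ^ 2 *
        (1 + p ^ (2 * n + 1))) * h4
    have ih' := ih (by omega)
    rw [show 2 * (n + 1) = 2 * n + 1 + 1 by ring, qPoch_succ, qPochPlus_succ, qPochPlus_succ,
      qPoch_succ p, qPoch_succ p, ← ih']
    linear_combination (qPoch (p ^ 2) n ^ 2 * qPochPlus p (2 * n) * (1 - p ^ (2 * n + 2))) * hrec

theorem baileySum_unit {p : L} (hp0 : p ≠ 0) (hp : ∀ n : ℕ, (p ^ 2) ^ (n + 1) ≠ 1) (N n : ℕ)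
    (hn : n + 1 ≤ N) :
    baileySum (p ^ 2) N (fun r => intSign r * p ^ (r ^ 2 - r)) (n + 1) = 0 := by
  have hz : ∑ r ∈ Finset.Icc (-N : ℤ) N, ((intSign r : L) * p ^ (r ^ 2 + r)) *
      ((1 - (p ^ 2) ^ ((n + 1 : ℕ) - r : ℤ)) *
        (qInv (p ^ 2) ((n + 1 : ℕ) - r) * qInv (p ^ 2) ((n + 1 : ℕ) + r))) = 0 :=
    sum_shifted_kernel_eq_zero hp N _ (fun r => by
      rw [intSign_cast_neg_one_sub, show (-1 - r) ^ 2 + (-1 - r) = r ^ 2 + r by ring]; ring) _ hn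
  have hz' := hz
  rw [← sum_Icc_neg] at hz'
  -- With Q = (p²)^(n+1), 1 - Q² = (1 - Q p^(2r)) + Q(p^(2r) - Q): the left side is the reflected
  -- vanishing sum plus Q times the original one. Since 1 - Q² ≠ 0, the Bailey sum vanishes.
  have h : baileySum (p ^ 2) N (fun r => (intSign r : L) * p ^ (r ^ 2 - r)) (n + 1) *
      (1 - (p ^ 2) ^ (n + 1) * (p ^ 2) ^ (n + 1)) = 0 + (p ^ 2) ^ (n + 1) * 0 := by
    rw [baileySum, Finset.sum_mul]
    nth_rewrite 2 [← hz]
    rw [← hz', Finset.mul_sum, ← Finset.sum_add_distrib]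
    refine Finset.sum_congr rfl fun r _ => ?_
    have h1 : (p ^ 2) ^ ((n + 1 : ℕ) - r : ℤ) * (p ^ 2) ^ r = (p ^ 2) ^ (n + 1) := by
      rw [← zpow_add₀ (pow_ne_zero 2 hp0), sub_add_cancel, zpow_natCast]
    have h2 : p ^ (r ^ 2 + r) = p ^ (r ^ 2 - r) * (p ^ 2) ^ r := by
      rw [← zpow_natCast, ← zpow_mul, ← zpow_add₀ hp0]
      congr 1
      push_cast
      ring
    have h3 : (p ^ 2) ^ ((n + 1 : ℕ) + r : ℤ) = (p ^ 2) ^ (n + 1) * (p ^ 2) ^ r := by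
      rw [zpow_add₀ (pow_ne_zero 2 hp0), zpow_natCast]
    rw [intSign_neg, neg_sq, sub_neg_eq_add, ← sub_eq_add_neg, ← sub_eq_add_neg, h2, h3, ← h1]
    ring
  rw [mul_zero, add_zero, mul_eq_zero] at h
  refine h.resolve_right ?_
  rw [← pow_add, show n + 1 + (n + 1) = (2 * n + 1) + 1 by ring]
  exact sub_ne_zero.mpr (hp _).symm

/-- The closed form telescopes in N. At N = 0 it vanishes because r ≠ 0 makes one of `qInv q (-r)`,
`qInv q r` zero. -/
theorem sum_conjugate_bailey {q : L} (hq : ∀ n : ℕ, q ^ (n + 1) ≠ 1) (hq0 : q ≠ 0)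
    {r : ℤ} (hr : r ≠ 0) (N : ℕ) :
    ∑ n ∈ Finset.range N, qPoch q n ^ 2 * q ^ (n + 1) *
      (qInv q ((n + 1 : ℕ) - r) * qInv q ((n + 1 : ℕ) + r)) =
    q ^ r / (1 - q ^ r) ^ 2 * (qPoch q N ^ 2 * (qInv q (N - r) * qInv q (N + r))) := by
  have hr1 : (1 : L) - q ^ r ≠ 0 := by
    rw [sub_ne_zero]
    intro h
    rcases lt_or_gt_of_ne hr with h0 | h0
    · apply hq ((-r).toNat - 1)
      rw [← zpow_natCast, show (((-r).toNat - 1 + 1 : ℕ) : ℤ) = -r by omega, zpow_neg, ← h, inv_one]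
    · apply hq (r.toNat - 1)
      rw [← zpow_natCast, show ((r.toNat - 1 + 1 : ℕ) : ℤ) = r by omega, ← h]
  induction N with
  | zero =>
    rw [Finset.sum_range_zero, Nat.cast_zero, zero_sub, zero_add, qInv_neg_mul_self q hr]
    ring
  | succ N ih =>
    rw [Finset.sum_range_succ, ih,
      show ((N : ℕ) : ℤ) - r = ((N + 1 : ℕ) - r) - 1 by push_cast; ring,
      show ((N : ℕ) : ℤ) + r = ((N + 1 : ℕ) + r) - 1 by push_cast; ring, qInv_pred hq, qInv_pred hq,
      qPoch_succ, zpow_sub₀ hq0, zpow_add₀ hq0, zpow_natCast]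
    have hqr : q ^ r ≠ 0 := zpow_ne_zero r hq0
    field_simp
    ring

theorem sum_Icc_fold {A : Type*} [AddCommMonoid A] (N : ℕ) (g : ℤ → A) :
    ∑ r ∈ Finset.Icc (-N : ℤ) N, g r =
      g 0 + ∑ n ∈ Finset.range N, (g (n + 1 : ℕ) + g (-(n + 1 : ℕ))) := by
  induction N with
  | zero => simp
  | succ N ih =>
    have h : Finset.Icc (-(N + 1 : ℕ) : ℤ) (N + 1 : ℕ) =
        insert ((N + 1 : ℕ) : ℤ) (insert (-(N + 1 : ℕ) : ℤ) (Finset.Icc (-N : ℤ) N)) := by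
      ext x
      simp only [Finset.mem_Icc, Finset.mem_insert]
      omega
    rw [h, Finset.sum_insert, Finset.sum_insert, ih, Finset.sum_range_succ]
    · rw [← add_assoc, add_comm, add_assoc]
    · simp only [Finset.mem_Icc]
      omega
    · simp only [Finset.mem_Icc, Finset.mem_insert]
      omega

/-- The limiting case of Bailey's lemma that produces smallest parts functions. -/
theorem sum_baileySum {q : L} (hq : ∀ n : ℕ, q ^ (n + 1) ≠ 1) (hq0 : q ≠ 0) (N : ℕ) (A : ℤ → L) :
    ∑ n ∈ Finset.range N, qPoch q n ^ 2 * q ^ (n + 1) * baileySum q N A (n + 1) =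
      A 0 * ∑ n ∈ Finset.range N, q ^ (n + 1) / (1 - q ^ (n + 1)) ^ 2 +
      ∑ n ∈ Finset.range N, (A (n + 1 : ℕ) + A (-(n + 1 : ℕ))) *
        (q ^ (n + 1) / (1 - q ^ (n + 1)) ^ 2) *
        (qPoch q N ^ 2 * ((qPoch q (N - (n + 1)))⁻¹ * (qPoch q (N + (n + 1)))⁻¹)) := by
  have h0 : ∑ n ∈ Finset.range N, qPoch q n ^ 2 * q ^ (n + 1) *
      (qInv q ((n + 1 : ℕ) - 0) * qInv q ((n + 1 : ℕ) + 0)) =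
      ∑ n ∈ Finset.range N, q ^ (n + 1) / (1 - q ^ (n + 1)) ^ 2 := by
    refine Finset.sum_congr rfl fun n _ => ?_
    rw [sub_zero, add_zero, qInv_natCast, qPoch_succ]
    have h1 := qPoch_ne_zero hq n
    have h2 : (1 : L) - q ^ (n + 1) ≠ 0 := sub_ne_zero.mpr (hq n).symm
    field_simp
  simp only [baileySum, Finset.mul_sum]
  -- After interchanging the sums, r = 0 has no telescoped form and stays a Lambert sum, while r and
  -- -r share one closed form.
  rw [Finset.sum_comm, sum_Icc_fold, ← Finset.mul_sum, ← h0, Finset.mul_sum]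
  congr 1
  · exact Finset.sum_congr rfl fun n _ => by ring
  · refine Finset.sum_congr rfl fun m hm => ?_
    rw [Finset.mem_range] at hm
    have hr : ((m + 1 : ℕ) : ℤ) ≠ 0 := by omega
    have h1 := sum_conjugate_bailey hq hq0 hr N
    rw [show (N : ℤ) - (m + 1 : ℕ) = (N - (m + 1) : ℕ) by omega,
      show (N : ℤ) + (m + 1 : ℕ) = (N + (m + 1) : ℕ) by omega, qInv_natCast, qInv_natCast,
      zpow_natCast] at h1
    rw [mul_assoc, ← h1, add_mul, Finset.mul_sum, Finset.mul_sum]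
    congr 1
    · exact Finset.sum_congr rfl fun n _ => by ring
    · refine Finset.sum_congr rfl fun n _ => ?_
      rw [sub_neg_eq_add, ← sub_eq_add_neg]
      ring

end FiniteBailey

/-! ### Geometric expansions and their truncations -/

theorem X_pow_mul_qSum {ι R : Type*} [CommRing R] {e : ι → ℤ} {w : ι → R} (h : QSummable e w)
    (k : ℕ) : X ^ k * qSum e w = qSum (fun i => k + e i) w := by
  have h1 : (X ^ k : R⟦X⟧) = qSum (fun _ : Unit => (k : ℤ)) fun _ => (1 : R) := by
    ext n
    rw [coeff_X_pow, coeff_qSum_eq_sum n {()} fun i _ _ => by simp]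
    simp [eq_comm]
  have h2 : QSummable (fun _ : Unit => (k : ℤ)) fun _ => (1 : R) :=
    ⟨fun _ _ => by positivity, fun N => Set.toFinite _⟩
  rw [h1, qSum_mul h2 h, ← qSum_equiv (Equiv.punitProd ι).symm]
  exact qSum_congr (fun i => by simp) fun i _ => rfl

theorem qSummable_multiples {R : Type*} [CommRing R] {k : ℕ} (hk : 0 < k) (c : ℤ → R) :
    QSummable (fun m : ℤ => (k : ℤ) * m) fun m => if 1 ≤ m then c m else 0 := by
  have hk' : (1 : ℤ) ≤ k := by exact_mod_cast hk
  have key : ∀ m : ℤ, (if 1 ≤ m then c m else 0) ≠ 0 → 1 ≤ m := fun m hm => by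
    by_contra h
    exact hm (if_neg h)
  refine ⟨fun m hm => ?_, fun N => (Set.finite_Icc 1 N).subset fun m hm => ?_⟩
  · have := key m hm
    positivity
  · have := key m hm.1
    have := hm.2
    constructor <;> nlinarith

theorem one_sub_X_pow_mul_qSum_telescope {R : Type*} [CommRing R] {k : ℕ} (hk : 0 < k) (c : ℤ → R)
    (hc : c 0 = 0) :
    (1 - X ^ k) * qSum (fun m : ℤ => (k : ℤ) * m) (fun m => if 1 ≤ m then c m else 0) =
      qSum (fun m : ℤ => (k : ℤ) * m) (fun m => if 1 ≤ m then c m - c (m - 1) else 0) := by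
  rw [sub_mul, one_mul, X_pow_mul_qSum (qSummable_multiples hk c), sub_eq_iff_eq_add]
  conv_rhs =>
    arg 2
    rw [← qSum_equiv (Equiv.subRight (1 : ℤ))]
  have h1 : qSum (fun i => (k : ℤ) + (k : ℤ) * (Equiv.subRight (1 : ℤ)) i)
      (fun i => if 1 ≤ (Equiv.subRight (1 : ℤ)) i then c ((Equiv.subRight (1 : ℤ)) i) else 0) =
      qSum (fun m : ℤ => (k : ℤ) * m) fun m => if 1 ≤ m then c (m - 1) else 0 := by
    refine qSum_congr (fun m => ?_) fun m _ => ?_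
    · simp only [Equiv.subRight_apply]
      split_ifs with h2 h3 h3
      · rfl
      · omega
      · rw [show m = 1 by omega, sub_self, hc]
      · rfl
    · simp only [Equiv.subRight_apply]
      ring
  rw [h1, ← qSum_add (qSummable_multiples hk _) (qSummable_multiples hk _)]
  exact qSum_congr (fun m => by split_ifs <;> simp) fun _ _ => rfl

theorem one_sub_X_pow_mul_qSum {R : Type*} [CommRing R] {k : ℕ} (hk : 0 < k) :
    (1 - X ^ k) * qSum (fun m : ℤ => (k : ℤ) * m) (fun m => if 1 ≤ m then (1 : R) else 0) =
      X ^ k := by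
  -- The constant 1 is replaced by the indicator of m ≠ 0, which agrees with it on m ≥ 1 and
  -- vanishes at 0; its difference survives only at m = 1.
  have h2 : qSum (fun m : ℤ => (k : ℤ) * m) (fun m => if 1 ≤ m then (1 : R) else 0) =
      qSum (fun m : ℤ => (k : ℤ) * m) (fun m => if 1 ≤ m then if m = 0 then 0 else 1 else 0) := by
    refine qSum_congr (fun m => ?_) fun _ _ => rfl
    split_ifs with h1 h2
    · omega
    · rfl
    · rfl
  rw [h2, one_sub_X_pow_mul_qSum_telescope hk (fun m => if m = 0 then 0 else 1) (by simp)]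
  ext n
  rw [coeff_qSum_eq_sum n {1} fun m hm _ => ?_, coeff_X_pow]
  · simp [eq_comm]
  · rw [Finset.mem_singleton]
    by_contra h
    apply hm
    split_ifs with h1 h2 h3 <;> first | omega | simp

theorem one_sub_X_pow_sq_mul_qSum {R : Type*} [CommRing R] {k : ℕ} (hk : 0 < k) :
    (1 - X ^ k) ^ 2 * qSum (fun m : ℤ => (k : ℤ) * m) (fun m => if 1 ≤ m then (m : R) else 0) =
      X ^ k := by
  rw [sq, mul_assoc, one_sub_X_pow_mul_qSum_telescope hk (fun m => (m : R)) (by simp)]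
  refine Eq.trans (congrArg _ (qSum_congr (fun m => ?_) fun _ _ => rfl)) (one_sub_X_pow_mul_qSum hk)
  split_ifs
  · push_cast; ring
  · rfl

/-- The power series `u / (1 - u)^2`. -/
noncomputable def koebe (u : ℚ⟦X⟧) : ℚ⟦X⟧ := u * (1 - u)⁻¹ ^ 2

theorem koebe_X_pow {k : ℕ} (hk : 0 < k) : koebe (X ^ k) =
    qSum (fun m : ℤ => (k : ℤ) * m) fun m => if 1 ≤ m then (m : ℚ) else 0 := by
  have h : (1 - X ^ k : ℚ⟦X⟧) * (1 - X ^ k)⁻¹ = 1 :=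
    PowerSeries.mul_inv_cancel _ (by simp [hk.ne'])
  rw [koebe]
  nth_rewrite 1 [← one_sub_X_pow_sq_mul_qSum (R := ℚ) hk]
  linear_combination (qSum (fun m : ℤ => (k : ℤ) * m) fun m => if 1 ≤ m then (m : ℚ) else 0) *
    ((1 - X ^ k) * (1 - X ^ k)⁻¹ + 1) * h

/-- The series `∑ c a * m * q^(e a + d a m)` over positive integers `a`, `m`. -/
noncomputable def pairSeries (e : ℤ → ℤ) (d : ℕ) (c : ℤ → ℤ) : ℤ⟦X⟧ :=
  qSum (fun x : ℤ × ℤ => e x.1 + d * (x.1 * x.2)) fun x =>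
    if 1 ≤ x.1 ∧ 1 ≤ x.2 then c x.1 * x.2 else 0

/-- Truncation at a ≤ N is exact through degree N, since e a ≥ 0 and d, m ≥ 1 make the exponent at
least a. -/
theorem X_pow_dvd_pairSeries_sub (e : ℤ → ℤ) (he : ∀ a, 0 ≤ e a) {d : ℕ} (hd : 0 < d) (c : ℤ → ℤ)
    (N : ℕ) :
    X ^ (N + 1) ∣ PowerSeries.map (Int.castRingHom ℚ) (pairSeries e d c) -
      ∑ a ∈ Finset.range N, (c (a + 1 : ℕ) : ℚ⟦X⟧) * X ^ (e (a + 1 : ℕ)).toNat *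
        koebe (X ^ (d * (a + 1))) := by
  have hs : QSummable (fun x : ℤ × ℤ => e x.1 + d * (x.1 * x.2)) fun x =>
      if 1 ≤ x.1 ∧ 1 ≤ x.2 then c x.1 * x.2 else 0 := by
    refine qSummable_of_pos _ fun x h1 h2 => ?_
    have := he x.1
    have hd' : (1 : ℤ) ≤ d := by exact_mod_cast hd
    have : x.1 * x.2 ≤ d * (x.1 * x.2) := by
      nlinarith [mul_pos (show 0 < x.1 by omega) (show 0 < x.2 by omega)]
    constructor <;> nlinarith
  rw [X_pow_dvd_iff]
  intro n hn
  rw [map_sub, sub_eq_zero, pairSeries, map_qSum _ hs, coeff_qSum_prod (hs.mono fun i hi h0 =>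
    hi (by simp [h0])) n ((Finset.range N).image fun a : ℕ => ((a + 1 : ℕ) : ℤ)),
      Finset.sum_image (fun a _ b _ h => by simpa using h), map_sum]
  · refine Finset.sum_congr rfl fun a _ => ?_
    have hk : 0 < d * (a + 1) := by positivity
    rw [koebe_X_pow hk, mul_assoc, X_pow_mul_qSum (qSummable_multiples hk _),
      ← map_intCast (C (R := ℚ)), coeff_C_mul, ← coeff_C_mul, ← qSum_const_mul]
    · refine congrArg _ (qSum_congr (fun m => ?_) fun m _ => ?_)
      · by_cases hm : 1 ≤ m
        · have ha : (1 : ℤ) ≤ (a + 1 : ℕ) := by push_cast; omega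
          simp [hm]
        · simp [hm]
      · rw [Int.toNat_of_nonneg (he _)]
        push_cast
        ring
    · have h1 := qSummable_multiples hk (fun m => (m : ℚ))
      have h2 := he (a + 1 : ℕ)
      refine ⟨fun m hm => by have := h1.nonneg m hm; omega, fun M => (h1.finite M).subset ?_⟩
      exact fun m hm => ⟨hm.1, by have := hm.2; omega⟩
  · intro p hp hp'
    have h : 1 ≤ p.1 ∧ 1 ≤ p.2 := by
      by_contra h
      exact hp (by simp [h])
    have h1 := he p.1
    have hd' : (1 : ℤ) ≤ d := by exact_mod_cast hd
    have h2 : p.1 * p.2 ≤ d * (p.1 * p.2) := by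
      nlinarith [mul_pos (show 0 < p.1 by omega) (show 0 < p.2 by omega)]
    have h3 : p.1 ≤ n := by nlinarith
    simp only [Finset.mem_image, Finset.mem_range]
    exact ⟨(p.1 - 1).toNat, by omega, by omega⟩

/-! ### Bailey identities in ℚ⟦X⟧, pulled back from its fraction field, where X is not a root of
unity -/

section Transfer

local notation "ι" => algebraMap ℚ⟦X⟧ (FractionRing ℚ⟦X⟧)

theorem algebraMap_fractionRing_inv {u : ℚ⟦X⟧} (hu : constantCoeff u ≠ 0) : ι u⁻¹ = (ι u)⁻¹ := by
  refine eq_inv_of_mul_eq_one_left ?_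
  rw [← map_mul, PowerSeries.inv_mul_cancel _ hu, map_one]

theorem map_qPoch {A B : Type*} [CommRing A] [CommRing B] (f : A →+* B) (q : A) (n : ℕ) :
    f (qPoch q n) = qPoch (f q) n := by simp [qPoch]

theorem map_qPochPlus {A B : Type*} [CommRing A] [CommRing B] (f : A →+* B) (q : A) (n : ℕ) :
    f (qPochPlus q n) = qPochPlus (f q) n := by simp [qPochPlus]

theorem constantCoeff_qPoch {R : Type*} [CommRing R] {d : ℕ} (hd : 0 < d) (n : ℕ) :
    constantCoeff (qPoch (X ^ d : R⟦X⟧) n) = 1 := by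
  rw [map_qPoch]
  simp [qPoch, hd.ne']

theorem constantCoeff_qPochPlus {R : Type*} [CommRing R] {d : ℕ} (hd : 0 < d) (n : ℕ) :
    constantCoeff (qPochPlus (X ^ d : R⟦X⟧) n) = 1 := by
  rw [map_qPochPlus]
  simp [qPochPlus, hd.ne']

theorem algebraMap_X_pow_ne_one {d : ℕ} (hd : 0 < d) (n : ℕ) : (ι X ^ d) ^ (n + 1) ≠ 1 := by
  rw [← map_pow, ← map_pow, ← map_one ι, Ne, (IsFractionRing.injective ℚ⟦X⟧ _).eq_iff]
  intro h
  have := congrArg constantCoeff h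
  simp [hd.ne'] at this

theorem algebraMap_X_ne_zero : ι X ≠ 0 := by
  rw [← map_zero ι, Ne, (IsFractionRing.injective ℚ⟦X⟧ _).eq_iff]
  exact X_ne_zero

theorem algebraMap_koebe {d : ℕ} (hd : 0 < d) :
    ι (koebe (X ^ d)) = ι X ^ d / (1 - ι X ^ d) ^ 2 := by
  rw [koebe, map_mul, map_pow, map_pow, algebraMap_fractionRing_inv (by simp [hd.ne']),
    map_sub, map_one,
    map_pow, inv_pow, div_eq_mul_inv]

/-- The ratio `(q)_N ^ 2 / ((q)_(N-r) (q)_(N+r))`. -/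
noncomputable def qPochRatio (q : ℚ⟦X⟧) (N r : ℕ) : ℚ⟦X⟧ :=
  qPoch q N ^ 2 * ((qPoch q (N - r))⁻¹ * (qPoch q (N + r))⁻¹)

theorem algebraMap_qPochRatio {d : ℕ} (hd : 0 < d) (N r : ℕ) : ι (qPochRatio (X ^ d) N r) =
    qPoch (ι X ^ d) N ^ 2 * ((qPoch (ι X ^ d) (N - r))⁻¹ * (qPoch (ι X ^ d) (N + r))⁻¹) := by
  have h := fun n => constantCoeff_qPoch (R := ℚ) hd n
  rw [qPochRatio, map_mul, map_mul, map_pow, algebraMap_fractionRing_inv (by simp [h]),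
    algebraMap_fractionRing_inv (by simp [h]), map_qPoch, map_qPoch, map_qPoch, map_pow]

theorem X_pow_dvd_qPoch_sub {d : ℕ} (hd : 0 < d) (m k : ℕ) :
    (X : ℚ⟦X⟧) ^ (m + 1) ∣ qPoch (X ^ d) (m + k) - qPoch (X ^ d) m := by
  induction k with
  | zero => simp
  | succ k ih =>
    rw [← add_assoc, qPoch_succ, mul_one_sub, sub_right_comm]
    refine dvd_sub ih (Dvd.dvd.mul_left ?_ _)
    rw [← pow_mul]
    exact pow_dvd_pow _ (by nlinarith)

theorem X_pow_dvd_qPochRatio_sub_one {d : ℕ} (hd : 0 < d) {N r : ℕ} (hr : r ≤ N) :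
    (X : ℚ⟦X⟧) ^ (N - r + 1) ∣ qPochRatio (X ^ d) N r - 1 := by
  obtain ⟨a, ha⟩ := X_pow_dvd_qPoch_sub hd (N - r) r
  obtain ⟨b, hb⟩ := (pow_dvd_pow (X : ℚ⟦X⟧) (show N - r + 1 ≤ N + 1 by omega)).trans
    (X_pow_dvd_qPoch_sub hd N r)
  rw [Nat.sub_add_cancel hr] at ha
  have h1 := PowerSeries.mul_inv_cancel (qPoch (X ^ d : ℚ⟦X⟧) (N - r))
    (by simp [constantCoeff_qPoch hd])
  have h2 := PowerSeries.mul_inv_cancel (qPoch (X ^ d : ℚ⟦X⟧) (N + r))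
    (by simp [constantCoeff_qPoch hd])
  rw [qPochRatio]
  set A := qPoch (X ^ d : ℚ⟦X⟧) (N - r)
  set B := qPoch (X ^ d : ℚ⟦X⟧) (N + r)
  set P := qPoch (X ^ d : ℚ⟦X⟧) N
  refine ⟨A⁻¹ * B⁻¹ * (a * P - A * b), ?_⟩
  linear_combination (A⁻¹ * B⁻¹ * P) * ha - (A⁻¹ * B⁻¹ * A) * hb + (B * B⁻¹) * h1 + h2

theorem intSign_natCast (n : ℕ) : intSign (n : ℤ) = (-1) ^ n := by
  induction n with
  | zero => simp [intSign]
  | succ n ih =>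
    rw [Nat.cast_succ, intSign_add, ih, pow_succ]
    simp [intSign]

/-- `sum_baileySum` for the pair in `baileySum_gauss`: (q)_n² divided by (q)_(n+1) (-q)_(n+1) is (1
- q^(n+1))^(-2) (q)_(n+1)/(-q)_(n+1). -/
theorem sum_koebe_gauss (N : ℕ) :
    ∑ n ∈ Finset.range N, koebe (X ^ (n + 1)) * (qPoch X (n + 1) * (qPochPlus X (n + 1))⁻¹) =
      ∑ n ∈ Finset.range N, koebe (X ^ (n + 1)) +
      ∑ n ∈ Finset.range N, 2 * (-1) ^ (n + 1) * X ^ (n + 1) ^ 2 * koebe (X ^ (n + 1)) *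
        qPochRatio (X ^ 1) N (n + 1) := by
  have hq := algebraMap_X_pow_ne_one one_pos
  have hq0 := algebraMap_X_ne_zero
  rw [pow_one] at hq
  have h := sum_baileySum hq hq0 N fun r => (intSign r : FractionRing ℚ⟦X⟧) * ι X ^ (r ^ 2)
  apply IsFractionRing.injective ℚ⟦X⟧ (FractionRing ℚ⟦X⟧)
  simp only [map_add, map_sum, map_mul, map_pow, map_neg, map_one, map_ofNat,
    algebraMap_koebe (show 0 < _ + 1 from Nat.succ_pos _), algebraMap_qPochRatio one_pos, map_qPoch]
  refine Eq.trans (Finset.sum_congr rfl fun n hn => ?_) (h.trans ?_)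
  · rw [Finset.mem_range] at hn
    have h1 := baileySum_gauss hq0 hq N (n + 1) hn
    rw [algebraMap_fractionRing_inv (by
      rw [← pow_one X, constantCoeff_qPochPlus one_pos]; exact one_ne_zero), map_qPochPlus]
    have h2 : qPochPlus (ι X) (n + 1) ≠ 0 := fun h0 => by simp [h0] at h1
    have h3 := qPoch_ne_zero hq n
    have h4 : 1 - ι X ^ (n + 1) ≠ 0 := sub_ne_zero.mpr (hq n).symm
    rw [eq_inv_of_mul_eq_one_left h1, qPoch_succ]
    field_simp
  · congr 1
    · simp [intSign]
    · refine Finset.sum_congr rfl fun n _ => ?_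
      rw [pow_one, intSign_neg, neg_sq, intSign_natCast,
        show (((n + 1 : ℕ) : ℤ) ^ 2) = ((n + 1) ^ 2 : ℕ) by push_cast; ring, zpow_natCast]
      push_cast
      ring

/-- The same in base q², with the pair in `baileySum_jacobi`; this one serves even smallest parts.
-/
theorem sum_koebe_jacobi (N : ℕ) :
    ∑ n ∈ Finset.range N, koebe (X ^ (2 * (n + 1))) *
        (qPoch X (2 * (n + 1)) * (qPochPlus X (2 * (n + 1)))⁻¹) =
      ∑ n ∈ Finset.range N, koebe (X ^ (2 * (n + 1))) +
      ∑ n ∈ Finset.range N, 2 * (-1) ^ (n + 1) * X ^ (n + 1) ^ 2 * koebe (X ^ (2 * (n + 1))) *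
        qPochRatio (X ^ 2) N (n + 1) := by
  have hq := algebraMap_X_pow_ne_one two_pos
  have hq0 := algebraMap_X_ne_zero
  have h := sum_baileySum hq (pow_ne_zero 2 hq0) N
    fun r => (intSign r : FractionRing ℚ⟦X⟧) * ι X ^ (r ^ 2)
  apply IsFractionRing.injective ℚ⟦X⟧ (FractionRing ℚ⟦X⟧)
  simp only [map_add, map_sum, map_mul, map_pow, map_neg, map_one, map_ofNat,
    algebraMap_koebe (show 0 < 2 * (_ + 1) by positivity), algebraMap_qPochRatio two_pos, map_qPoch]
  simp only [pow_mul]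
  refine Eq.trans (Finset.sum_congr rfl fun n hn => ?_) (h.trans ?_)
  · rw [Finset.mem_range] at hn
    have h1 := baileySum_jacobi hq0 hq N (n + 1) hn
    have hc : constantCoeff (qPochPlus (X : ℚ⟦X⟧) (2 * (n + 1))) = 1 := by
      rw [← pow_one X, constantCoeff_qPochPlus one_pos]
    rw [algebraMap_fractionRing_inv (by rw [hc]; exact one_ne_zero), map_qPochPlus, ← h1]
    have h2 : qPochPlus (ι X) (2 * (n + 1)) ≠ 0 := fun h0 => by
      rw [← map_qPochPlus, ← map_zero ι, (IsFractionRing.injective ℚ⟦X⟧ _).eq_iff] at h0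
      rw [h0, map_zero] at hc
      exact zero_ne_one hc
    have h4 : 1 - (ι X ^ 2) ^ (n + 1) ≠ 0 := sub_ne_zero.mpr (hq n).symm
    rw [qPoch_succ]
    field_simp
  · congr 1
    · simp [intSign]
    · refine Finset.sum_congr rfl fun n _ => ?_
      rw [intSign_neg, neg_sq, intSign_natCast,
        show (((n + 1 : ℕ) : ℤ) ^ 2) = ((n + 1) ^ 2 : ℕ) by push_cast; ring, zpow_natCast]
      push_cast
      ring

theorem sum_koebe_unit (N : ℕ) :
    0 = ∑ n ∈ Finset.range N, koebe (X ^ (2 * (n + 1))) +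
      ∑ n ∈ Finset.range N, (-1) ^ (n + 1) * X ^ (n + 1) ^ 2 *
        (koebe (X ^ (n + 1)) - 2 * koebe (X ^ (2 * (n + 1)))) * qPochRatio (X ^ 2) N (n + 1) := by
  have hq := algebraMap_X_pow_ne_one two_pos
  have hq' := algebraMap_X_pow_ne_one one_pos
  rw [pow_one] at hq'
  have hq0 := algebraMap_X_ne_zero
  have h := sum_baileySum hq (pow_ne_zero 2 hq0) N
    fun r => (intSign r : FractionRing ℚ⟦X⟧) * ι X ^ (r ^ 2 - r)
  apply IsFractionRing.injective ℚ⟦X⟧ (FractionRing ℚ⟦X⟧)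
  simp only [map_add, map_sub, map_sum, map_mul, map_pow, map_neg, map_one, map_ofNat, map_zero,
    algebraMap_koebe (show 0 < 2 * (_ + 1) by positivity),
    algebraMap_koebe (show 0 < _ + 1 from Nat.succ_pos _),
    algebraMap_qPochRatio two_pos]
  refine Eq.trans (Finset.sum_eq_zero fun n hn => ?_).symm (h.trans ?_)
  · rw [Finset.mem_range] at hn
    rw [baileySum_unit hq0 hq N n hn, mul_zero]
  · simp only [pow_mul]
    congr 1
    · simp [intSign]
    -- With x = q^(n+1), the terms ±(n+1) give (x + x³)/(1-x²)² = x/(1-x)² - 2x²/(1-x²)².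
    · refine Finset.sum_congr rfl fun n _ => ?_
      congr 1
      rw [intSign_neg, neg_sq, intSign_natCast, sub_neg_eq_add]
      have h1 : ι X ^ (((n + 1 : ℕ) : ℤ) ^ 2 - (n + 1 : ℕ)) * ι X ^ (n + 1) =
          ι X ^ (n + 1) ^ 2 := by
        rw [← zpow_natCast, ← zpow_natCast, ← zpow_add₀ hq0]
        congr 1
        push_cast
        ring
      have h2 : ι X ^ (((n + 1 : ℕ) : ℤ) ^ 2 + (n + 1 : ℕ)) =
          ι X ^ (n + 1) ^ 2 * ι X ^ (n + 1) := by
        rw [← zpow_natCast, ← zpow_natCast, ← zpow_add₀ hq0]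
        congr 1
      have h3 : (ι X ^ 2) ^ (n + 1) = (ι X ^ (n + 1)) ^ 2 := by ring
      have h4 : 1 - (ι X ^ (n + 1)) ^ 2 ≠ 0 := by
        rw [← h3]
        exact sub_ne_zero.mpr (hq n).symm
      have h5 : 1 - ι X ^ (n + 1) ≠ 0 := sub_ne_zero.mpr (hq' n).symm
      rw [h2, h3, ← h1]
      push_cast
      field_simp
      ring

/-- The Gauss pair at the top level n = N, times (q)_N²: a finite form of θ = ∏ (1-q^n)/(1+q^n). -/
theorem qPoch_mul_inv_eq_sum (N : ℕ) :
    qPoch X N * (qPochPlus X N)⁻¹ = 1 + ∑ n ∈ Finset.range N,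
      2 * (-1) ^ (n + 1) * X ^ (n + 1) ^ 2 * qPochRatio (X ^ 1) N (n + 1) := by
  have hq := algebraMap_X_pow_ne_one one_pos
  have hq0 := algebraMap_X_ne_zero
  rw [pow_one] at hq
  have h := baileySum_gauss hq0 hq N N le_rfl
  apply IsFractionRing.injective ℚ⟦X⟧ (FractionRing ℚ⟦X⟧)
  simp only [map_add, map_sum, map_mul, map_pow, map_neg, map_one, map_ofNat,
    algebraMap_qPochRatio one_pos, map_qPoch]
  rw [algebraMap_fractionRing_inv (by
      rw [← pow_one X, constantCoeff_qPochPlus one_pos]; exact one_ne_zero), map_qPochPlus]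
  have h2 : qPochPlus (ι X) N ≠ 0 := fun h0 => by simp [h0] at h
  have h3 := qPoch_ne_zero hq N
  have h4 : qPoch (ι X) N * (qPochPlus (ι X) N)⁻¹ = qPoch (ι X) N ^ 2 *
      baileySum (ι X) N (fun r => (intSign r : FractionRing ℚ⟦X⟧) * ι X ^ (r ^ 2)) N := by
    rw [eq_inv_of_mul_eq_one_left h]
    field_simp
  rw [h4, baileySum, sum_Icc_fold, mul_add, Finset.mul_sum]
  congr 1
  · rw [sub_zero, add_zero, qInv_natCast]
    simp only [intSign]
    field_simp
    simp
  · refine Finset.sum_congr rfl fun n hn => ?_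
    rw [Finset.mem_range] at hn
    rw [sub_neg_eq_add, ← sub_eq_add_neg, show (N : ℤ) - (n + 1 : ℕ) = (N - (n + 1) : ℕ) by omega,
      show (N : ℤ) + (n + 1 : ℕ) = (N + (n + 1) : ℕ) by omega, qInv_natCast, qInv_natCast,
      pow_one, intSign_neg, neg_sq, intSign_natCast,
      show (((n + 1 : ℕ) : ℤ) ^ 2) = ((n + 1) ^ 2 : ℕ) by push_cast; ring, zpow_natCast]
    push_cast
    ring

end Transfer

/-! ### Passage to the limit N → ∞ -/

/-- Replacing the ratio by 1 at r = n + 1 costs an error of order N - r + 1, and the factor X^(r²)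
with r² ≥ r lifts it above degree N. -/
theorem X_pow_dvd_sum_qPochRatio_sub {d : ℕ} (hd : 0 < d) (N : ℕ) (g : ℕ → ℚ⟦X⟧)
    (hg : ∀ n, X ^ (n + 1) ^ 2 ∣ g n) :
    X ^ (N + 1) ∣ ∑ n ∈ Finset.range N, g n * qPochRatio (X ^ d) N (n + 1) -
      ∑ n ∈ Finset.range N, g n := by
  rw [← Finset.sum_sub_distrib]
  refine Finset.dvd_sum fun n hn => ?_
  rw [Finset.mem_range] at hn
  rw [← mul_sub_one]
  refine dvd_trans (pow_dvd_pow X ?_) (pow_add (X : ℚ⟦X⟧) ((n + 1) ^ 2) (N - (n + 1) + 1) ▸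
    mul_dvd_mul (hg n) (X_pow_dvd_qPochRatio_sub_one hd (show n + 1 ≤ N by omega)))
  have : n + 1 ≤ (n + 1) ^ 2 := by nlinarith
  omega

theorem eq_of_forall_X_pow_dvd_sub {R : Type*} [CommRing R] {f g : R⟦X⟧}
    (h : ∀ N : ℕ, X ^ (N + 1) ∣ f - g) : f = g := by
  ext n
  have := X_pow_dvd_iff.mp (h n) n (Nat.lt_succ_self n)
  rwa [map_sub, sub_eq_zero] at this

theorem pairSeries_zero (d : ℕ) : pairSeries (fun _ => 0) d (fun _ => 1) = sigmaSeries 1 d := by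
  rw [sigmaSeries, ← lambert_swap, pairSeries, lambert]
  exact qSum_congr (fun x => by simp) fun x _ => by simp

theorem pairSeries_sq_two : pairSeries (fun a => a ^ 2) 2 intSign = rankSeries 1 := by
  rw [pairSeries, rankSeries]
  exact qSum_congr (fun x => by simp) fun x _ => by push_cast; ring

local notation "toRat" => PowerSeries.map (Int.castRingHom ℚ)

theorem map_intCast_injective : Function.Injective toRat :=
  PowerSeries.map_injective _ Int.cast_injective

theorem X_pow_dvd_sigmaSeries_sub {d : ℕ} (hd : 0 < d) (N : ℕ) :
    X ^ (N + 1) ∣ toRat (sigmaSeries 1 d) -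
      ∑ n ∈ Finset.range N, koebe (X ^ (d * (n + 1))) := by
  have h := X_pow_dvd_pairSeries_sub (fun _ => 0) (fun _ => le_rfl) hd (fun _ => 1) N
  simpa [pairSeries_zero] using h

theorem X_pow_dvd_pairSeries_sq_sub {d : ℕ} (hd : 0 < d) (N : ℕ) :
    X ^ (N + 1) ∣ toRat (pairSeries (fun a => a ^ 2) d intSign) -
      ∑ n ∈ Finset.range N, (-1) ^ (n + 1) * X ^ (n + 1) ^ 2 * koebe (X ^ (d * (n + 1))) := by
  have h := X_pow_dvd_pairSeries_sub (fun a => a ^ 2) (fun a => sq_nonneg a) hd intSign N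
  have h1 : ∀ n : ℕ, (((n + 1 : ℕ) : ℤ) ^ 2).toNat = (n + 1) ^ 2 := fun n => by
    rw [← Nat.cast_pow, Int.toNat_natCast]
  simpa only [intSign_natCast, h1, Int.cast_pow, Int.cast_neg, Int.cast_one] using h

theorem X_pow_dvd_theta_sub (N : ℕ) :
    X ^ (N + 1) ∣ toRat theta - qPoch X N * (qPochPlus X N)⁻¹ := by
  have h1 := X_pow_dvd_sum_qPochRatio_sub one_pos N (fun n => 2 * (-1) ^ (n + 1) * X ^ (n + 1) ^ 2)
    fun n => Dvd.intro_left _ rfl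
  have h2 : X ^ (N + 1) ∣ toRat theta -
      (1 + ∑ n ∈ Finset.range N, 2 * (-1) ^ (n + 1) * X ^ (n + 1) ^ 2) := by
    rw [X_pow_dvd_iff]
    intro m hm
    rw [map_sub, sub_eq_zero, theta, thetaMoment, map_qSum _ (qSummable_sq _),
      coeff_qSum_eq_sum m (Finset.Icc (-N : ℤ) N) fun t _ ht => ?_, sum_Icc_fold, map_add, map_sum]
    · congr 1
      · simp [intSign, coeff_one, eq_comm]
      · refine Finset.sum_congr rfl fun n _ => ?_
        rw [intSign_neg, neg_sq, intSign_natCast, show (2 * (-1) ^ (n + 1) : ℚ⟦X⟧) =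
          C (2 * (-1) ^ (n + 1)) by simp [map_ofNat C], coeff_C_mul, coeff_X_pow]
        have : ((n + 1 : ℕ) : ℤ) ^ 2 = m ↔ m = (n + 1) ^ 2 := by
          rw [← Nat.cast_pow, Nat.cast_inj, eq_comm]
        simp only [this]
        split_ifs
        · simp
          ring
        · simp
    · rw [Finset.mem_Icc]
      constructor <;> nlinarith
  rw [qPoch_mul_inv_eq_sum]
  convert dvd_sub h2 h1 using 1
  ring

/-- The first two moment series of level one reduce to those of level two. -/
theorem pairSeries_sq_one :
    pairSeries (fun a => a ^ 2) 1 intSign = 2 * rankSeries 1 - sigmaSeries 1 2 := by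
  apply map_intCast_injective
  rw [← pairSeries_sq_two]
  refine eq_of_forall_X_pow_dvd_sub fun N => ?_
  have h1 := X_pow_dvd_sum_qPochRatio_sub two_pos N (fun n => (-1) ^ (n + 1) * X ^ (n + 1) ^ 2 *
    (koebe (X ^ (n + 1)) - 2 * koebe (X ^ (2 * (n + 1)))))
    fun n => Dvd.dvd.mul_right (Dvd.intro_left _ rfl) _
  have h2 := X_pow_dvd_sigmaSeries_sub two_pos N
  have h3 := X_pow_dvd_pairSeries_sq_sub one_pos N
  have h4 := X_pow_dvd_pairSeries_sq_sub two_pos N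
  have h5 := sum_koebe_unit N
  have h6 : ∑ n ∈ Finset.range N, (-1) ^ (n + 1) * X ^ (n + 1) ^ 2 *
      (koebe (X ^ (n + 1)) - 2 * koebe (X ^ (2 * (n + 1)))) =
      ∑ n ∈ Finset.range N, (-1) ^ (n + 1) * X ^ (n + 1) ^ 2 * koebe (X ^ (1 * (n + 1))) -
      2 * ∑ n ∈ Finset.range N, (-1) ^ (n + 1) * X ^ (n + 1) ^ 2 * koebe (X ^ (2 * (n + 1))) := by
    rw [Finset.mul_sum, ← Finset.sum_sub_distrib]
    exact Finset.sum_congr rfl fun n _ => by rw [one_mul]; ring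
  convert dvd_sub (dvd_add (dvd_sub h3 (h4.mul_left 2)) h2) h1 using 1
  simp only [map_sub, map_mul, map_ofNat, Nat.cast_ofNat]
  linear_combination -h5 - h6

theorem X_pow_dvd_sum_koebe_sub (N : ℕ) :
    X ^ (N + 1) ∣ ∑ n ∈ Finset.range N,
        koebe (X ^ (n + 1)) * (qPoch X (n + 1) * (qPochPlus X (n + 1))⁻¹) -
      toRat (sigmaSeries 1 1 - 2 * sigmaSeries 1 2 + 4 * rankSeries 1) := by
  have h1 := X_pow_dvd_sum_qPochRatio_sub one_pos N (fun n => 2 * (-1) ^ (n + 1) *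
    X ^ (n + 1) ^ 2 * koebe (X ^ (n + 1))) fun n => Dvd.dvd.mul_right (Dvd.intro_left _ rfl) _
  have h2 := X_pow_dvd_sigmaSeries_sub one_pos N
  have h3 := X_pow_dvd_pairSeries_sq_sub one_pos N
  have h4 := congrArg toRat pairSeries_sq_one
  have h6 : ∑ n ∈ Finset.range N, 2 * (-1) ^ (n + 1) * X ^ (n + 1) ^ 2 * koebe (X ^ (n + 1)) =
      2 * ∑ n ∈ Finset.range N, (-1) ^ (n + 1) * X ^ (n + 1) ^ 2 * koebe (X ^ (1 * (n + 1))) := by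
    rw [Finset.mul_sum]
    exact Finset.sum_congr rfl fun n _ => by rw [one_mul]; ring
  rw [sum_koebe_gauss]
  convert dvd_sub (dvd_sub h1 h2) (h3.mul_left 2) using 1
  simp only [map_sub, map_add, map_mul, map_ofNat, Nat.cast_one, one_mul] at h4 h6 ⊢
  linear_combination h6 + 2 * h4

theorem X_pow_dvd_sum_koebe_even_sub (N : ℕ) :
    X ^ (N + 1) ∣ ∑ n ∈ Finset.range N, koebe (X ^ (2 * (n + 1))) *
        (qPoch X (2 * (n + 1)) * (qPochPlus X (2 * (n + 1)))⁻¹) -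
      toRat (sigmaSeries 1 2 + 2 * rankSeries 1) := by
  have h1 := X_pow_dvd_sum_qPochRatio_sub two_pos N (fun n => 2 * (-1) ^ (n + 1) *
    X ^ (n + 1) ^ 2 * koebe (X ^ (2 * (n + 1))))
    fun n => Dvd.dvd.mul_right (Dvd.intro_left _ rfl) _
  have h2 := X_pow_dvd_sigmaSeries_sub two_pos N
  have h3 := X_pow_dvd_pairSeries_sq_sub two_pos N
  have h6 : ∑ n ∈ Finset.range N, 2 * (-1) ^ (n + 1) * X ^ (n + 1) ^ 2 *
      koebe (X ^ (2 * (n + 1))) = 2 * ∑ n ∈ Finset.range N,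
        (-1) ^ (n + 1) * X ^ (n + 1) ^ 2 * koebe (X ^ (2 * (n + 1))) := by
    rw [Finset.mul_sum]
    exact Finset.sum_congr rfl fun n _ => by ring
  rw [sum_koebe_jacobi]
  convert dvd_sub (dvd_sub h1 h2) (h3.mul_left 2) using 1
  rw [pairSeries_sq_two]
  simp only [map_add, map_mul, map_ofNat, Nat.cast_ofNat]
  linear_combination h6

/-! ### Generating functions of the smallest parts functions -/

/-- The smallest part of a partition, and zero for the empty partition. -/
def Nat.Partition.minPart {n : ℕ} (p : n.Partition) : ℕ := p.parts.toFinset.min.untopD 0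

theorem Overpartition.sum_partition {n : ℕ} (F : n.Partition → ℕ) :
    ∑ l : Overpartition n, F l.partition = ∑ p : n.Partition, 2 ^ p.parts.toFinset.card * F p := by
  rw [show ∑ l : Overpartition n, F l.partition =
      ∑ x : Σ p : n.Partition, {S : Finset ℕ // S ∈ p.parts.toFinset.powerset}, F x.1 from
    Fintype.sum_equiv (equivSigma n) _ _ fun _ => rfl, Fintype.sum_sigma]
  refine Finset.sum_congr rfl fun p _ => ?_
  refine (Finset.sum_const (F p)).trans ?_
  rw [smul_eq_mul, Finset.card_univ, Fintype.card_coe, Finset.card_powerset]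

theorem Nat.Partition.minPart_eq_iff {n : ℕ} (p : n.Partition) {j : ℕ} (hj : 0 < j) :
    p.minPart = j ↔ j ∈ p.parts ∧ ∀ i ∈ p.parts, j ≤ i := by
  rcases Finset.eq_empty_or_nonempty p.parts.toFinset with h | h
  · have h0 : p.parts = 0 := by simpa using h
    simp [minPart, h0, hj.ne]
  · rw [minPart, ← Finset.coe_min' h, WithTop.untopD_coe]
    constructor
    · rintro rfl
      exact ⟨Multiset.mem_toFinset.mp (Finset.min'_mem _ h),
        fun i hi => Finset.min'_le _ _ (Multiset.mem_toFinset.mpr hi)⟩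
    · rintro ⟨h1, h2⟩
      exact le_antisymm (Finset.min'_le _ _ (Multiset.mem_toFinset.mpr h1))
        (Finset.le_min' _ _ _ fun i hi => h2 i (Multiset.mem_toFinset.mp hi))

theorem Nat.Partition.count_minPart_of_eq_zero {n : ℕ} (p : n.Partition) (h : p.minPart = 0) :
    p.parts.count p.minPart = 0 := by
  rw [h, Multiset.count_eq_zero]
  exact fun h0 => (p.parts_pos h0).ne rfl

theorem Nat.Partition.minPart_le {n : ℕ} (p : n.Partition) : p.minPart ≤ n := by
  rcases Nat.eq_zero_or_pos p.minPart with h | h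
  · omega
  · have := ((p.minPart_eq_iff h).mp rfl).1
    exact (Multiset.single_le_sum (fun _ _ => Nat.zero_le _) _ this).trans_eq p.parts_sum

/-- The character of overpartitions all of whose parts exceed `j`. -/
def largeChar (j i _c : ℕ) : ℚ := if i ≤ j then 0 else 2

/-- The character of overpartitions with no part below `j`, weighted by the multiplicity
of `j`. -/
def countChar (j i c : ℕ) : ℚ := if i < j then 0 else if i = j then 2 * c else 2

/-- A part below j kills both products, and if j is absent they coincide. If j is the minimum only
the first survives: each distinct part gives 2 (overlined or not), and j also its multiplicity. -/
theorem prod_countChar_sub_prod_largeChar {n : ℕ} (p : n.Partition) {j : ℕ} (hj : 0 < j) :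
    p.parts.toFinsupp.prod (countChar j) - p.parts.toFinsupp.prod (largeChar j) =
      if p.minPart = j then (2 : ℚ) ^ p.parts.toFinset.card * p.parts.count j else 0 := by
  simp only [Finsupp.prod, Multiset.toFinsupp_support, Multiset.toFinsupp_apply,
    p.minPart_eq_iff hj]
  by_cases h1 : ∃ i ∈ p.parts, i < j
  · obtain ⟨i, hi, hij⟩ := h1
    have hi' := Multiset.mem_toFinset.mpr hi
    rw [Finset.prod_eq_zero hi' (by simp [countChar, hij]),
      Finset.prod_eq_zero hi' (by simp [largeChar, hij.le]), if_neg, sub_zero]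
    exact fun h => absurd (h.2 i hi) (by omega)
  push Not at h1
  by_cases h2 : j ∈ p.parts
  · have h2' := Multiset.mem_toFinset.mpr h2
    have h3 : ∏ i ∈ p.parts.toFinset, largeChar j i (p.parts.count i) = 0 :=
      Finset.prod_eq_zero h2' (by simp [largeChar])
    rw [if_pos ⟨h2, h1⟩, h3, sub_zero,
      ← Finset.mul_prod_erase _ _ h2', Finset.prod_congr rfl (g := fun _ => (2 : ℚ)),
      Finset.prod_const, ← Finset.card_erase_add_one h2', pow_succ]
    · simp only [countChar, lt_irrefl, if_false, if_true]
      ring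
    · intro i hi
      rw [Finset.mem_erase, Multiset.mem_toFinset] at hi
      have := h1 i hi.2
      simp [countChar, hi.1, this]
  · rw [if_neg fun h => h2 h.1, sub_eq_zero]
    refine Finset.prod_congr rfl fun i hi => ?_
    rw [Multiset.mem_toFinset] at hi
    have h3 := h1 i hi
    have h4 : i ≠ j := fun h => h2 (h ▸ hi)
    rw [countChar, largeChar, if_neg (by omega), if_neg h4, if_neg (by omega)]

/-- The generating function of overpartitions all of whose parts exceed `j`. -/
noncomputable def largeSeries (j : ℕ) : ℚ⟦X⟧ := Nat.Partition.genFun (largeChar j)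

/-- The generating function of the number of occurrences of `j` in the overpartitions with
smallest part `j`. -/
noncomputable def smallestSeries (j : ℕ) : ℚ⟦X⟧ :=
  Nat.Partition.genFun (countChar j) - largeSeries j

theorem coeff_smallestSeries {j : ℕ} (hj : 0 < j) (n : ℕ) : coeff n (smallestSeries j) =
    ∑ p : n.Partition, if p.minPart = j then
      (2 : ℚ) ^ p.parts.toFinset.card * p.parts.count j else 0 := by
  rw [smallestSeries, largeSeries, map_sub, Nat.Partition.coeff_genFun, Nat.Partition.coeff_genFun,
    ← Finset.sum_sub_distrib]
  exact Finset.sum_congr rfl fun p _ => prod_countChar_sub_prod_largeChar p hj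

section Factor

open scoped PowerSeries.WithPiTopology

/-- In the Euler product over part sizes only the factor at j + 1 differs, and it equals 1 for f'.
-/
theorem genFun_eq_mul (f f' : ℕ → ℕ → ℚ) (j : ℕ) (hne : ∀ i, i ≠ j + 1 → f i = f' i)
    (h0 : f' (j + 1) = 0) : Nat.Partition.genFun f = Nat.Partition.genFun f' *
      (1 + ∑' k, f (j + 1) (k + 1) • (X : ℚ⟦X⟧) ^ ((j + 1) * (k + 1))) := by
  have h1 := Nat.Partition.hasProd_genFun f
  have h2 := (Nat.Partition.hasProd_genFun f').mul (hasProd_ite_eq j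
    (1 + ∑' k, f (j + 1) (k + 1) • (X : ℚ⟦X⟧) ^ ((j + 1) * (k + 1))))
  refine h1.unique (h2.congr_fun fun i => ?_)
  by_cases h : i = j
  · subst h
    simp [h0]
  · simp [h, hne (i + 1) (by omega)]

theorem constantCoeff_X_pow_succ (j : ℕ) : constantCoeff (X ^ (j + 1) : ℚ⟦X⟧) = 0 := by simp

/-- With x = X^(j+1), parts of size j + 1 contribute 1 + 2(x + x² + ⋯) = (1+x)/(1-x). -/
theorem largeSeries_mul (j : ℕ) :
    (1 - X ^ (j + 1)) * largeSeries j = (1 + X ^ (j + 1)) * largeSeries (j + 1) := by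
  have h1 := genFun_eq_mul (largeChar j) (largeChar (j + 1)) j
    (fun i hi => by
      ext c
      simp only [largeChar]
      congr 1
      simp only [eq_iff_iff]
      omega) (by ext c; simp [largeChar])
  have h2 := WithPiTopology.summable_pow_of_constantCoeff_eq_zero (constantCoeff_X_pow_succ j)
  have h3 := WithPiTopology.one_sub_mul_tsum_pow_of_constantCoeff_eq_zero
    (constantCoeff_X_pow_succ j)
  rw [h2.tsum_eq_zero_add, pow_zero] at h3
  have h4 : ∀ k, largeChar j (j + 1) (k + 1) • (X : ℚ⟦X⟧) ^ ((j + 1) * (k + 1)) =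
      2 * (X ^ (j + 1)) ^ (k + 1) := fun k => by
    rw [largeChar, if_neg (by omega), smul_eq_C_mul, map_ofNat, pow_mul]
  have h5 : Summable fun k => ((X : ℚ⟦X⟧) ^ (j + 1)) ^ (k + 1) :=
    (summable_nat_add_iff 1).mpr h2
  rw [largeSeries, largeSeries, h1]
  simp only [h4]
  rw [h5.tsum_mul_left]
  linear_combination (2 * Nat.Partition.genFun (largeChar (j + 1))) * h3

theorem genFun_countChar (j : ℕ) : Nat.Partition.genFun (countChar (j + 1)) =
    largeSeries (j + 1) * (1 + 2 * koebe (X ^ (j + 1))) := by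
  have h1 := genFun_eq_mul (countChar (j + 1)) (largeChar (j + 1)) j
    (fun i hi => by
      ext c
      simp only [countChar, largeChar, if_neg hi]
      congr 1
      simp only [eq_iff_iff]
      omega) (by ext c; simp [largeChar])
  set t : ℚ⟦X⟧ := X ^ (j + 1) with ht
  have h2 := WithPiTopology.summable_pow_of_constantCoeff_eq_zero (constantCoeff_X_pow_succ j)
  have h3 := WithPiTopology.one_sub_mul_tsum_pow_of_constantCoeff_eq_zero
    (constantCoeff_X_pow_succ j)
  rw [h2.tsum_eq_zero_add, pow_zero, ← ht] at h3
  have h4 : ∀ k, countChar (j + 1) (j + 1) (k + 1) • (X : ℚ⟦X⟧) ^ ((j + 1) * (k + 1)) =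
      2 * (((k + 1 : ℕ) : ℚ⟦X⟧) * t ^ (k + 1)) := fun k => by
    rw [countChar, if_neg (lt_irrefl _), if_pos rfl, smul_eq_C_mul, map_mul, map_ofNat, map_natCast,
      pow_mul, mul_assoc]
  have h5 : Summable fun k => ((X : ℚ⟦X⟧) ^ (j + 1)) ^ (k + 1) :=
    (summable_nat_add_iff 1).mpr h2
  have h6 : Summable fun k : ℕ => ((k + 1 : ℕ) : ℚ⟦X⟧) * t ^ (k + 1) := by
    have := Nat.Partition.summable_genFun_term (fun _ c => (c : ℚ)) j
    refine this.congr fun k => ?_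
    rw [smul_eq_C_mul, map_natCast, pow_mul]
  -- Multiplying ∑ k t^k by 1 - t takes differences of the coefficients, leaving ∑ t^k.
  have h7 : (1 - t) * ∑' k : ℕ, ((k + 1 : ℕ) : ℚ⟦X⟧) * t ^ (k + 1) = ∑' k, t ^ (k + 1) := by
    rw [sub_mul, one_mul, ← h6.tsum_mul_left, h6.tsum_eq_zero_add, h5.tsum_eq_zero_add,
      add_sub_assoc, ← Summable.tsum_sub ((summable_nat_add_iff 1).mpr h6) (h6.mul_left t)]
    congr 1
    · simp [ht]
    · refine tsum_congr fun k => ?_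
      push_cast
      ring
  have h8 : (1 - t) * (1 - t)⁻¹ = 1 := PowerSeries.mul_inv_cancel _ (by simp [ht])
  rw [h1]
  simp only [h4]
  rw [h6.tsum_mul_left, largeSeries]
  congr 2
  congr 1
  rw [koebe]
  set S := ∑' k : ℕ, ((k + 1 : ℕ) : ℚ⟦X⟧) * t ^ (k + 1)
  set T := ∑' k : ℕ, t ^ (k + 1)
  linear_combination (-(S * ((1 - t) * (1 - t)⁻¹ + 1)) ) * h8 + ((1 - t)⁻¹ ^ 2 * (1 - t)) * h7 +
    (1 - t)⁻¹ ^ 2 * h3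

end Factor

theorem smallestSeries_succ (j : ℕ) :
    smallestSeries (j + 1) = 2 * koebe (X ^ (j + 1)) * largeSeries (j + 1) := by
  rw [smallestSeries, genFun_countChar]
  ring

theorem qPoch_mul_largeSeries (n : ℕ) :
    qPoch X n * largeSeries 0 = qPochPlus X n * largeSeries n := by
  induction n with
  | zero => simp [qPoch, qPochPlus]
  | succ n ih =>
    rw [qPoch_succ, qPochPlus_succ]
    linear_combination (1 - X ^ (n + 1)) * ih + qPochPlus X n * largeSeries_mul n

theorem X_pow_dvd_largeSeries_sub_one (N : ℕ) : X ^ (N + 1) ∣ largeSeries N - 1 := by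
  rw [X_pow_dvd_iff]
  intro n hn
  rw [map_sub, sub_eq_zero, largeSeries, Nat.Partition.coeff_genFun, coeff_one]
  split_ifs with h
  · subst h
    simp [Nat.Partition.partition_zero_parts]
  · refine Finset.sum_eq_zero fun p _ => ?_
    obtain ⟨i, hi⟩ : ∃ i, i ∈ p.parts := by
      by_contra! h0
      have h1 := p.parts_sum
      rw [Multiset.eq_zero_of_forall_notMem h0] at h1
      exact h h1.symm
    have h2 : i ≤ n := (Multiset.single_le_sum (fun _ _ => Nat.zero_le _) _ hi).trans_eq p.parts_sum
    simp only [Finsupp.prod, Multiset.toFinsupp_support, Multiset.toFinsupp_apply]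
    exact Finset.prod_eq_zero (Multiset.mem_toFinset.mpr hi) (if_pos (by omega))

/-- `largeSeries N` is 1 through degree N, so the finite relation `qPoch_mul_largeSeries` and the
finite approximation of θ suffice. -/
theorem theta_mul_largeSeries_zero : toRat theta * largeSeries 0 = 1 := by
  refine eq_of_forall_X_pow_dvd_sub fun N => ?_
  have h1 := X_pow_dvd_theta_sub N
  have h2 := X_pow_dvd_largeSeries_sub_one N
  have h3 := qPoch_mul_largeSeries N
  have h4 : qPochPlus (X : ℚ⟦X⟧) N * (qPochPlus X N)⁻¹ = 1 := PowerSeries.mul_inv_cancel _ (by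
    rw [← pow_one X, constantCoeff_qPochPlus one_pos]; exact one_ne_zero)
  convert dvd_add (h1.mul_right (largeSeries 0)) h2 using 1
  linear_combination ((qPochPlus (X : ℚ⟦X⟧) N)⁻¹) * h3 + largeSeries N * h4

theorem theta_mul_largeSeries (n : ℕ) :
    toRat theta * largeSeries n = qPoch X n * (qPochPlus X n)⁻¹ := by
  have h3 := qPoch_mul_largeSeries n
  have h4 : qPochPlus (X : ℚ⟦X⟧) n * (qPochPlus X n)⁻¹ = 1 := PowerSeries.mul_inv_cancel _ (by
    rw [← pow_one X, constantCoeff_qPochPlus one_pos]; exact one_ne_zero)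
  linear_combination (-(toRat theta * (qPochPlus (X : ℚ⟦X⟧) n)⁻¹)) * h3 -
    (toRat theta * largeSeries n) * h4 +
      (qPoch X n * (qPochPlus X n)⁻¹) * theta_mul_largeSeries_zero

/-- The generating function of `sptBar`. -/
noncomputable def sptSeries : ℤ⟦X⟧ := PowerSeries.mk fun n => (sptBar n : ℤ)

/-- The generating function of `sptBar2`. -/
noncomputable def sptSeriesEven : ℤ⟦X⟧ := PowerSeries.mk fun n => (sptBar2 n : ℤ)

theorem sum_smallest_eq {n N : ℕ} (hn : n ≤ N) (m : ℕ) (hm : 0 < m) (P : ℕ → Prop)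
    [DecidablePred P] (hP : ∀ j, P j ↔ m ∣ j) :
    ((∑ l : Overpartition n, if P l.smallestPart then l.smallestPartCount else 0 : ℕ) : ℚ) =
      coeff n (∑ k ∈ Finset.range N, smallestSeries (m * (k + 1))) := by
  have h0 := Overpartition.sum_partition (n := n)
    fun p => if P p.minPart then p.parts.count p.minPart else 0
  have h1 : (∑ l : Overpartition n, if P l.smallestPart then l.smallestPartCount else 0) =
      ∑ p : n.Partition, 2 ^ p.parts.toFinset.card *
        (if P p.minPart then p.parts.count p.minPart else 0) := h0
  rw [h1, map_sum, Finset.sum_congr rfl fun k _ =>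
    coeff_smallestSeries (show 0 < m * (k + 1) by positivity) n, Finset.sum_comm, Nat.cast_sum]
  refine Finset.sum_congr rfl fun p _ => ?_
  by_cases hp : P p.minPart ∧ 0 < p.minPart
  · obtain ⟨k, hk⟩ := (hP _).mp hp.1
    have hk0 : k ≠ 0 := fun h => by simp [h] at hk; omega
    obtain ⟨k, rfl⟩ := Nat.exists_eq_add_one_of_ne_zero hk0
    have hkN : k < N := by
      have := p.minPart_le
      have : k + 1 ≤ m * (k + 1) := Nat.le_mul_of_pos_left _ hm
      omega
    rw [Finset.sum_eq_single_of_mem k (Finset.mem_range.mpr hkN), if_pos hp.1, if_pos hk, hk]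
    · push_cast
      ring
    · intro i _ hi
      refine if_neg fun h => hi ?_
      rw [hk] at h
      have := Nat.eq_of_mul_eq_mul_left hm h
      omega
  -- The empty partition has smallest part 0, which every m divides, but its multiplicity is 0.
  · have h2 : (if P p.minPart then p.parts.count p.minPart else 0) = 0 := by
      split_ifs with h
      · exact p.count_minPart_of_eq_zero (by
          by_contra h3
          exact hp ⟨h, Nat.pos_of_ne_zero h3⟩)
      · rfl
    rw [h2, mul_zero, Nat.cast_zero, Finset.sum_eq_zero]
    intro k _
    refine if_neg fun h => hp ⟨(hP _).mpr ⟨k + 1, h⟩, ?_⟩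
    rw [h]
    positivity

/-- θ turns `largeSeries j` into (q)_j/(-q)_j, which makes each summand 2 `smallestSeries`-type term
one of the Jacobi–Bailey sum. -/
theorem theta_mul_sptSeriesEven :
    theta * sptSeriesEven = 2 * sigmaSeries 1 2 + 4 * rankSeries 1 := by
  apply PowerSeries.map_injective (Int.castRingHom ℚ) Int.cast_injective
  refine eq_of_forall_X_pow_dvd_sub fun N => ?_
  have h1 : X ^ (N + 1) ∣ toRat sptSeriesEven -
      ∑ k ∈ Finset.range N, smallestSeries (2 * (k + 1)) := by
    rw [X_pow_dvd_iff]
    intro n hn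
    rw [map_sub, ← sum_smallest_eq (Nat.lt_succ_iff.mp hn) 2 two_pos _ fun j => even_iff_two_dvd]
    simp [sptSeriesEven, sptBar2]
  have h2 := X_pow_dvd_sum_koebe_even_sub N
  have h3 : toRat theta * ∑ k ∈ Finset.range N, smallestSeries (2 * (k + 1)) =
      2 * ∑ n ∈ Finset.range N, koebe (X ^ (2 * (n + 1))) *
        (qPoch X (2 * (n + 1)) * (qPochPlus X (2 * (n + 1)))⁻¹) := by
    rw [Finset.mul_sum, Finset.mul_sum]
    refine Finset.sum_congr rfl fun k _ => ?_
    rw [← theta_mul_largeSeries, show 2 * (k + 1) = (2 * k + 1) + 1 by ring, smallestSeries_succ]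
    ring
  convert dvd_add (h1.mul_left (toRat theta)) (h2.mul_left 2) using 1
  simp only [map_add, map_mul, map_ofNat]
  linear_combination h3

theorem theta_mul_sptSeries :
    theta * sptSeries = 2 * sigmaSeries 1 1 - 4 * sigmaSeries 1 2 + 8 * rankSeries 1 := by
  apply PowerSeries.map_injective (Int.castRingHom ℚ) Int.cast_injective
  refine eq_of_forall_X_pow_dvd_sub fun N => ?_
  have h1 : X ^ (N + 1) ∣ toRat sptSeries -
      ∑ k ∈ Finset.range N, smallestSeries (1 * (k + 1)) := by
    rw [X_pow_dvd_iff]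
    intro n hn
    rw [map_sub, ← sum_smallest_eq (Nat.lt_succ_iff.mp hn) 1 one_pos (fun _ => True)
        fun j => by simp,
      sub_eq_zero, sptSeries, coeff_map, coeff_mk, sptBar, sptBar1, sptBar2,
      ← Finset.sum_add_distrib, map_natCast]
    refine congrArg _ (Finset.sum_congr rfl fun l _ => ?_)
    rcases Nat.even_or_odd l.smallestPart with h | h
    · simp [h, Nat.not_odd_iff_even.mpr h]
    · simp [h, Nat.not_even_iff_odd.mpr h]
  have h2 := X_pow_dvd_sum_koebe_sub N
  have h3 : toRat theta * ∑ k ∈ Finset.range N, smallestSeries (1 * (k + 1)) =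
      2 * ∑ n ∈ Finset.range N, koebe (X ^ (n + 1)) *
        (qPoch X (n + 1) * (qPochPlus X (n + 1))⁻¹) := by
    rw [Finset.mul_sum, Finset.mul_sum]
    refine Finset.sum_congr rfl fun k _ => ?_
    rw [← theta_mul_largeSeries, one_mul, smallestSeries_succ]
    ring
  convert dvd_add (h1.mul_left (toRat theta)) (h2.mul_left 2) using 1
  simp only [map_add, map_sub, map_mul, map_ofNat]
  linear_combination h3

/-! ### The logarithmic derivative of theta -/

theorem X_pow_dvd_sigmaSeries_sub_geom {d : ℕ} (hd : 0 < d) (N : ℕ) :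
    X ^ (N + 1) ∣ toRat (sigmaSeries 1 d) - ∑ a ∈ Finset.range N,
      ((a + 1 : ℕ) : ℚ⟦X⟧) * (X ^ (d * (a + 1)) * (1 - X ^ (d * (a + 1)))⁻¹) := by
  have hd' : (1 : ℤ) ≤ d := by exact_mod_cast hd
  have hs := qSummable_lambert hd' fun x => x.1 ^ 1
  rw [X_pow_dvd_iff]
  intro n hn
  rw [map_sub, sub_eq_zero, sigmaSeries, lambert, map_qSum _ hs,
    coeff_qSum_prod (hs.mono fun i hi h0 =>
    hi (by rw [h0, map_zero])) n ((Finset.range N).image fun a : ℕ => ((a + 1 : ℕ) : ℤ)),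
      Finset.sum_image (fun a _ b _ h => by simpa using h), map_sum]
  · refine Finset.sum_congr rfl fun a _ => ?_
    have hk : 0 < d * (a + 1) := by positivity
    have h1 : (1 - X ^ (d * (a + 1)) : ℚ⟦X⟧) * (1 - X ^ (d * (a + 1)))⁻¹ = 1 :=
      PowerSeries.mul_inv_cancel _ (by simp [hd.ne'])
    have h2 : (X ^ (d * (a + 1)) : ℚ⟦X⟧) * (1 - X ^ (d * (a + 1)))⁻¹ =
        qSum (fun m : ℤ => ((d * (a + 1) : ℕ) : ℤ) * m) fun m => if 1 ≤ m then (1 : ℚ) else 0 := by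
      linear_combination (qSum (fun m : ℤ => ((d * (a + 1) : ℕ) : ℤ) * m)
        fun m => if 1 ≤ m then (1 : ℚ) else 0) * h1 -
          (1 - X ^ (d * (a + 1)))⁻¹ * one_sub_X_pow_mul_qSum (R := ℚ) hk
    rw [h2, ← map_natCast (C (R := ℚ)), ← qSum_const_mul (qSummable_multiples hk _)]
    refine congrArg _ (qSum_congr (fun m => ?_) fun m _ => ?_)
    · by_cases hm : 1 ≤ m
      · have ha : (1 : ℤ) ≤ (a + 1 : ℕ) := by push_cast; omega
        simp [hm]
      · simp [hm]
    · push_cast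
      ring
  · intro p hp hp'
    have h : 1 ≤ p.1 ∧ 1 ≤ p.2 := by
      by_contra h
      exact hp (by simp [h])
    have h2 : p.1 * p.2 ≤ d * (p.1 * p.2) := by
      nlinarith [mul_pos (show 0 < p.1 by omega) (show 0 < p.2 by omega)]
    have h3 : p.1 ≤ n := by nlinarith
    simp only [Finset.mem_image, Finset.mem_range]
    exact ⟨(p.1 - 1).toNat, by omega, by omega⟩

theorem qDeriv_X_pow {R : Type*} [CommRing R] (k : ℕ) :
    qDeriv R (X ^ k) = (k : R⟦X⟧) * X ^ k := by
  ext n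
  rw [coeff_qDeriv, ← map_natCast (C (R := R)), coeff_C_mul, coeff_X_pow]
  split_ifs with h <;> simp [h]

theorem qDeriv_qPoch (N : ℕ) : qDeriv ℚ (qPoch X N) = -(∑ a ∈ Finset.range N,
    ((a + 1 : ℕ) : ℚ⟦X⟧) * (X ^ (a + 1) * (1 - X ^ (a + 1))⁻¹)) * qPoch X N := by
  induction N with
  | zero => simp [qPoch]
  | succ n ih =>
    have h1 : (1 - X ^ (n + 1) : ℚ⟦X⟧) * (1 - X ^ (n + 1))⁻¹ = 1 :=
      PowerSeries.mul_inv_cancel _ (by simp)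
    rw [qPoch_succ, Derivation.leibniz, ih, map_sub, Derivation.map_one_eq_zero, qDeriv_X_pow,
      Finset.sum_range_succ]
    simp only [smul_eq_mul]
    linear_combination ((n + 1 : ℕ) : ℚ⟦X⟧) * X ^ (n + 1) * qPoch X n * h1

theorem qDeriv_qPochPlus (N : ℕ) : qDeriv ℚ (qPochPlus X N) = (∑ a ∈ Finset.range N,
    ((a + 1 : ℕ) : ℚ⟦X⟧) * (X ^ (a + 1) * (1 + X ^ (a + 1))⁻¹)) * qPochPlus X N := by
  induction N with
  | zero => simp [qPochPlus]
  | succ n ih =>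
    have h1 : (1 + X ^ (n + 1) : ℚ⟦X⟧) * (1 + X ^ (n + 1))⁻¹ = 1 :=
      PowerSeries.mul_inv_cancel _ (by simp)
    rw [qPochPlus_succ, Derivation.leibniz, ih, map_add, Derivation.map_one_eq_zero, qDeriv_X_pow,
      Finset.sum_range_succ]
    simp only [smul_eq_mul]
    linear_combination (-((n + 1 : ℕ) : ℚ⟦X⟧) * X ^ (n + 1) * qPochPlus X n) * h1

theorem X_pow_dvd_qDeriv {R : Type*} [CommRing R] {f : R⟦X⟧} {k : ℕ} (h : X ^ k ∣ f) :
    X ^ k ∣ qDeriv R f := by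
  rw [X_pow_dvd_iff] at h ⊢
  intro n hn
  rw [coeff_qDeriv, h n hn, mul_zero]

/-- The logarithmic derivative of the theta series. -/
theorem qDeriv_theta : qDeriv ℤ theta = 2 * (sigmaSeries 1 2 - sigmaSeries 1 1) * theta := by
  apply map_intCast_injective
  refine eq_of_forall_X_pow_dvd_sub fun N => ?_
  set P : ℚ⟦X⟧ := qPoch X N with hP
  set Q : ℚ⟦X⟧ := qPochPlus X N with hQ
  have hQ1 : Q * Q⁻¹ = 1 := PowerSeries.mul_inv_cancel _ (by
    rw [hQ, ← pow_one X, constantCoeff_qPochPlus one_pos]; exact one_ne_zero)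
  let g : ℕ → ℚ⟦X⟧ := fun d => ∑ a ∈ Finset.range N,
    ((a + 1 : ℕ) : ℚ⟦X⟧) * (X ^ (d * (a + 1)) * (1 - X ^ (d * (a + 1)))⁻¹)
  have h1 : X ^ (N + 1) ∣ toRat (sigmaSeries 1 1) - g 1 := X_pow_dvd_sigmaSeries_sub_geom one_pos N
  have h2 : X ^ (N + 1) ∣ toRat (sigmaSeries 1 2) - g 2 := X_pow_dvd_sigmaSeries_sub_geom two_pos N
  have h3 := X_pow_dvd_theta_sub N
  have h4 := qDeriv_qPoch N
  have h5 := qDeriv_qPochPlus N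
  have h6 := X_pow_dvd_qDeriv h3
  have h7 : qDeriv ℚ Q * Q⁻¹ + Q * qDeriv ℚ Q⁻¹ = 0 := by
    have := congrArg (qDeriv ℚ) hQ1
    rw [Derivation.leibniz, Derivation.map_one_eq_zero] at this
    simp only [smul_eq_mul] at this
    linear_combination this
  rw [← hP] at h3 h4 h6
  rw [← hQ] at h3 h5 h6
  -- x/(1-x) + x/(1+x) = 2x/(1-x²) = 2(x/(1-x) - x²/(1-x²)).
  have h8 : ∑ a ∈ Finset.range N, ((a + 1 : ℕ) : ℚ⟦X⟧) * (X ^ (a + 1) * (1 - X ^ (a + 1))⁻¹) +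
      ∑ a ∈ Finset.range N, ((a + 1 : ℕ) : ℚ⟦X⟧) * (X ^ (a + 1) * (1 + X ^ (a + 1))⁻¹) =
      2 * (g 1 - g 2) := by
    simp only [g]
    rw [← Finset.sum_add_distrib, ← Finset.sum_sub_distrib, Finset.mul_sum]
    refine Finset.sum_congr rfl fun a _ => ?_
    rw [one_mul, mul_comm 2 (a + 1), pow_mul]
    set x : ℚ⟦X⟧ := X ^ (a + 1) with hx
    have e1 : (1 - x) * (1 - x)⁻¹ = 1 := PowerSeries.mul_inv_cancel _ (by simp [hx])
    have e2 : (1 + x) * (1 + x)⁻¹ = 1 := PowerSeries.mul_inv_cancel _ (by simp [hx])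
    have e3 : (1 - x ^ 2)⁻¹ = (1 - x)⁻¹ * (1 + x)⁻¹ := by
      have e4 : (1 - x ^ 2) * (1 - x ^ 2)⁻¹ = 1 := PowerSeries.mul_inv_cancel _ (by simp [hx])
      linear_combination (-(1 - x ^ 2)⁻¹ * ((1 + x) * (1 + x)⁻¹)) * e1 - (1 - x ^ 2)⁻¹ * e2 +
        (1 - x)⁻¹ * (1 + x)⁻¹ * e4
    rw [e3]
    linear_combination ((a + 1 : ℕ) : ℚ⟦X⟧) * x * ((1 - x)⁻¹ * e2 - (1 + x)⁻¹ * e1)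
  have h9 : qDeriv ℚ (P * Q⁻¹) = -(∑ a ∈ Finset.range N,
      ((a + 1 : ℕ) : ℚ⟦X⟧) * (X ^ (a + 1) * (1 - X ^ (a + 1))⁻¹) + ∑ a ∈ Finset.range N,
      ((a + 1 : ℕ) : ℚ⟦X⟧) * (X ^ (a + 1) * (1 + X ^ (a + 1))⁻¹)) * (P * Q⁻¹) := by
    rw [Derivation.leibniz]
    rw [h5] at h7
    simp only [smul_eq_mul]
    set B := ∑ a ∈ Finset.range N, ((a + 1 : ℕ) : ℚ⟦X⟧) * (X ^ (a + 1) * (1 + X ^ (a + 1))⁻¹)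
    linear_combination P * Q⁻¹ * h7 - P * (B * Q⁻¹ + qDeriv ℚ Q⁻¹) * hQ1 + Q⁻¹ * h4
  rw [map_sub, h9, h8] at h6
  simp only [map_qDeriv, map_mul, map_sub, map_ofNat]
  convert dvd_add (dvd_add h6 (h3.mul_left (2 * (g 1 - g 2))))
    ((dvd_sub h1 h2).mul_left (2 * toRat theta)) using 1
  ring

/-! ### The substitution q ↦ q^k -/

section Expand

variable {ι R : Type*} [CommRing R]

theorem expand_qSum {k : ℕ} (hk : k ≠ 0) {e : ι → ℤ} {w : ι → R} (h : QSummable e w) :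
    PowerSeries.expand k hk (qSum e w) = qSum (fun i => k * e i) w := by
  ext n
  obtain ⟨s, hs⟩ := h.exists_finset n
  have hle : ∀ m : ℕ, (m : ℤ) ≤ (k : ℤ) * m := fun m => by
    exact_mod_cast Nat.le_mul_of_pos_left m (Nat.pos_of_ne_zero hk)
  rw [coeff_qSum_eq_sum (e := fun i => k * e i) n s fun i hi hi' => hs i hi ?_]
  · by_cases hn : k ∣ n
    · obtain ⟨m, rfl⟩ := hn
      rw [coeff_expand_mul, coeff_qSum_eq_sum m s fun i hi hi' => hs i hi ?_]
      · refine Finset.sum_congr rfl fun i _ => ?_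
        simp [hk]
      · rw [hi', Nat.cast_mul]
        exact hle m
    · rw [coeff_expand_of_not_dvd _ _ _ hn, Finset.sum_eq_zero]
      intro i _
      exact if_neg fun hi => hn (Int.natCast_dvd_natCast.mp ⟨e i, hi.symm⟩)
  · have h0 := h.nonneg i hi
    rw [← hi']
    have := Nat.pos_of_ne_zero hk
    nlinarith

theorem qDeriv_expand {k : ℕ} (hk : k ≠ 0) (f : R⟦X⟧) :
    qDeriv R (PowerSeries.expand k hk f) = (k : R⟦X⟧) * PowerSeries.expand k hk (qDeriv R f) := by
  ext n
  rw [coeff_qDeriv, ← map_natCast (C (R := R)), coeff_C_mul]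
  by_cases hn : k ∣ n
  · obtain ⟨m, rfl⟩ := hn
    rw [coeff_expand_mul, coeff_expand_mul, coeff_qDeriv]
    push_cast
    ring
  · rw [coeff_expand_of_not_dvd _ _ _ hn, coeff_expand_of_not_dvd _ _ _ hn, mul_zero, mul_zero]

end Expand

theorem expand_sigmaSeries (k : ℕ) : PowerSeries.expand 2 two_ne_zero (sigmaSeries k 1) =
    sigmaSeries k 2 := by
  rw [sigmaSeries, lambert, expand_qSum two_ne_zero (qSummable_lambert le_rfl _), sigmaSeries,
    lambert]
  simp

/-- The substitution q ↦ q² doubles D, which halves the coefficient 6 of the derivative. -/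
theorem twelve_mul_sigmaSeries_two_sq :
    12 * sigmaSeries 1 2 ^ 2 =
      5 * sigmaSeries 3 2 + sigmaSeries 1 2 - 3 * qDeriv ℤ (sigmaSeries 1 2) := by
  have h := congrArg (PowerSeries.expand 2 two_ne_zero) twelve_mul_sigmaSeries_sq
  have h2 := qDeriv_expand two_ne_zero (sigmaSeries 1 1)
  simp only [map_mul, map_sub, map_add, map_pow, map_ofNat, expand_sigmaSeries] at h h2
  push_cast at h2
  linear_combination h + 3 * h2

/-! ### Reduction modulo p -/

section Reduction

variable {p : ℕ}

/-- Reduction of power series modulo `p`. -/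
noncomputable def reduceMod (p : ℕ) : ℤ⟦X⟧ →+* (ZMod p)⟦X⟧ :=
    PowerSeries.map (Int.castRingHom (ZMod p))

theorem reduceMod_qDeriv (f : ℤ⟦X⟧) :
    reduceMod p (qDeriv ℤ f) = qDeriv (ZMod p) (reduceMod p f) := map_qDeriv _ _

theorem reduceMod_qSum_congr {ι : Type*} {e : ι → ℤ} {w v : ι → ℤ} (hw : QSummable e w)
    (hv : QSummable e v) (h : ∀ i, (w i : ZMod p) = v i) :
    reduceMod p (qSum e w) = reduceMod p (qSum e v) := by
  rw [reduceMod, map_qSum _ hw, map_qSum _ hv]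
  exact qSum_congr h fun _ _ => rfl

theorem reduceMod_sigmaSeries_congr {k l : ℕ} (h : ∀ z : ZMod p, z ^ k = z ^ l) {d : ℤ}
    (hd : 1 ≤ d) :
    reduceMod p (sigmaSeries k d) = reduceMod p (sigmaSeries l d) := by
  refine reduceMod_qSum_congr (qSummable_lambert hd _) (qSummable_lambert hd _) fun x => ?_
  split_ifs
  · push_cast
    exact h _
  · rfl

theorem reduceMod_rankSeries_congr {k l : ℕ} (h : ∀ z : ZMod p, z ^ k = z ^ l) :
    reduceMod p (rankSeries k) = reduceMod p (rankSeries l) := by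
  refine reduceMod_qSum_congr (qSummable_rankSeries _) (qSummable_rankSeries _) fun x => ?_
  split_ifs
  · push_cast
    rw [h]
  · rfl

theorem reduceMod_thetaMoment_congr {k l : ℕ} (h : ∀ z : ZMod p, z ^ k = z ^ l) :
    reduceMod p (thetaMoment k) = reduceMod p (thetaMoment l) := by
  refine reduceMod_qSum_congr (qSummable_sq _) (qSummable_sq _) fun t => ?_
  push_cast
  rw [h]

theorem isUnit_reduceMod_theta (p : ℕ) : IsUnit (reduceMod p theta) := by
  have h : constantCoeff theta = 1 := by
    rw [← coeff_zero_eq_constantCoeff_apply, theta, thetaMoment,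
      coeff_qSum_eq_sum 0 {0} fun t _ ht => by simpa using ht]
    simp [intSign]
  exact (isUnit_iff_constantCoeff.mpr (by rw [h]; exact isUnit_one)).map (reduceMod p)

theorem coeff_reduceMod_sptSeries (p n : ℕ) :
    coeff n (reduceMod p sptSeries) = (sptBar n : ZMod p) := by
  simp [reduceMod, sptSeries]

theorem coeff_reduceMod_sptSeriesEven (p n : ℕ) :
    coeff n (reduceMod p sptSeriesEven) = (sptBar2 n : ZMod p) := by
  simp [reduceMod, sptSeriesEven]

end Reduction

theorem natCast_eq_zero_powerSeries (p : ℕ) : ((p : ℕ) : (ZMod p)⟦X⟧) = 0 := by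
  rw [← map_natCast (C (R := ZMod p)), ZMod.natCast_self, map_zero]

/-! ### Differential algebra in characteristic 3 and 5 -/

section Algebra

variable {R A : Type*} [CommRing R] [CommRing A] [Algebra R A] (D : Derivation R A A)

theorem Derivation.map_ofNat_eq_zero (n : ℕ) [n.AtLeastTwo] : D (OfNat.ofNat n : A) = 0 :=
  D.map_natCast n

variable {φ ρ F G S s t a : A}

theorem Derivation.eq_neg_mul_of_mul_eq_one {y : A} (hρ : φ * ρ = 1) (hφ : D φ = y * φ) :
    D ρ = -y * ρ := by
  have h := congrArg D hρ
  rw [D.leibniz, D.map_one_eq_zero, hφ] at h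
  simp only [smul_eq_mul] at h
  linear_combination ρ * h - (D ρ + y * ρ) * hρ

/-- Differentiating `hS` writes φ²(S + DS) as four times the heat expression plus terms in t and Dt;
the heat relation cancels everything modulo 3. -/
theorem add_derivation_eq_zero_of_three_eq_zero (h3 : (3 : A) = 0) (hφ : IsUnit φ)
    (hS : φ * S = 2 * t + 4 * F)
    (hF : 8 * (φ * D F + φ * F - D φ * F) =
      16 * D φ * t + 8 * φ * t - 4 * φ * D t + D (D φ) - D φ)
    (hφ' : D (D φ) = D φ) : S + D S = 0 := by
  have h := congrArg D hS
  simp only [map_add, D.leibniz, smul_eq_mul, D.map_ofNat_eq_zero] at h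
  refine (hφ.mul hφ).mul_left_cancel ?_
  linear_combination φ * hS + φ * h - D φ * hS + 2 * hF + 2 * hφ' +
    (6 * t * φ - 2 * φ * D t + 10 * D φ * t - 4 * (φ * D F + φ * F - D φ * F)) * h3

/-- F cancels in T - 2S, leaving φ(T - 2S) = 2s - 8t ≡ 2(s - t), which is minus the logarithmic
derivative of φ. -/
theorem sub_eq_derivation_of_three_eq_zero {T : A} (h3 : (3 : A) = 0) (hρ : φ * ρ = 1)
    (hφ : D φ = 2 * (t - s) * φ) (hS : φ * S = 2 * t + 4 * F)
    (hT : φ * T = 2 * s - 4 * t + 8 * F) : T - 2 * S = D ρ := by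
  rw [D.eq_neg_mul_of_mul_eq_one hρ hφ]
  linear_combination (2 * S - T) * hρ + ρ * hT - 2 * ρ * hS - 2 * ρ * t * h3

theorem heat_one_of_logDeriv {y : A} (hφ : IsUnit φ) (hφ' : D φ = y * φ)
    (hF : 8 * (φ * D F + φ * G - D φ * F) =
      16 * D φ * t + 8 * φ * a - 4 * φ * D t + D (D φ) - D φ) :
    8 * (D F + G - y * F) = 16 * y * t + 8 * a - 4 * D t + (D y + y ^ 2) - y := by
  have h : D (D φ) = (D y + y ^ 2) * φ := by
    rw [hφ', D.leibniz, hφ']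
    simp only [smul_eq_mul]
    ring
  rw [h, hφ'] at hF
  refine hφ.mul_left_cancel ?_
  linear_combination hF

theorem heat_three_of_logDeriv {y : A} (hφ : IsUnit φ) (hφ' : D φ = y * φ)
    (hG : 24 * (φ * D G + φ * F - D φ * G) =
      48 * D (D φ) * t + 216 * D φ * a - 108 * D φ * D t + 24 * φ * t - 36 * φ * D a +
        12 * φ * D (D t) + D (D (D φ)) - 2 * D (D φ) + D φ) :
    24 * (D G + F - y * G) = 48 * (D y + y ^ 2) * t + 216 * y * a - 108 * y * D t + 24 * t -
      36 * D a + 12 * D (D t) + (D (D y) + 3 * y * D y + y ^ 3) - 2 * (D y + y ^ 2) + y := by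
  have h : D (D φ) = (D y + y ^ 2) * φ := by
    rw [hφ', D.leibniz, hφ']
    simp only [smul_eq_mul]
    ring
  have h' : D (D (D φ)) = (D (D y) + 3 * y * D y + y ^ 3) * φ := by
    rw [h]
    simp only [D.leibniz, D.leibniz_pow, map_add, hφ', smul_eq_mul, nsmul_eq_mul]
    push_cast
    ring
  rw [h', h, hφ'] at hG
  refine hφ.mul_left_cancel ?_
  linear_combination hG

theorem eq_derivation_sub_of_five_eq_zero (h5 : (5 : A) = 0) (hρ : φ * ρ = 1)
    (hφ : D φ = 2 * (t - s) * φ) (hs : D s = s - 2 * s ^ 2) (ht : D t = t ^ 2 + 2 * t)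
    (hF : 8 * (φ * D F + φ * G - D φ * F) =
      16 * D φ * t + 8 * φ * a - 4 * φ * D t + D (D φ) - D φ)
    (hG : 24 * (φ * D G + φ * F - D φ * G) =
      48 * D (D φ) * t + 216 * D φ * a - 108 * D φ * D t + 24 * φ * t - 36 * φ * D a +
        12 * φ * D (D t) + D (D (D φ)) - 2 * D (D φ) + D φ) :
    (∀ S, φ * S = 2 * t + 4 * F → ∃ H, S = D H - 3 * H) ∧
      ∀ S, φ * S = 2 * s - 6 * t + 4 * F → ∃ H, S = D H := by
  have hu : IsUnit φ := IsUnit.of_mul_eq_one _ hρ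
  have h1 := heat_one_of_logDeriv D hu hφ hF
  have h3 := heat_three_of_logDeriv D hu hφ hG
  have hρ' := D.eq_neg_mul_of_mul_eq_one hρ hφ
  simp only [map_add, map_sub, D.leibniz, D.leibniz_pow, smul_eq_mul, nsmul_eq_mul,
    D.map_ofNat_eq_zero, map_zero, hs, ht] at h1 h3
  -- Modulo 5, `h3` determines DG - Da, so a and G enter only through a - G and Da never appears. As
  -- Ds, Dt and DF are also expressed without derivatives, the remaining coefficients solve a linear
  -- system modulo 5.
  refine ⟨fun S hS => ⟨ρ * (4 * t + 4 * t ^ 2 + 2 * s ^ 2 + 2 * a + F - 2 * G), ?_⟩,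
    fun S hS => ⟨ρ * (2 + t + 3 * t ^ 2 + 3 * s + 4 * s ^ 2 + 4 * a - 4 * G), ?_⟩⟩
  · simp only [map_add, map_sub, D.leibniz, D.leibniz_pow, smul_eq_mul, nsmul_eq_mul,
      D.map_ofNat_eq_zero, hs, ht, hρ']
    push_cast at h1 h3 ⊢
    linear_combination ρ * hS - S * hρ + 3 * ρ * h1 + 3 * ρ * h3 +
      ρ * (-14 * D G - 5 * D F - 6 * G - 13 * F - 22 * D a + 6 * a + 42 * t + 28 * t * G + 10 * t *
      F + 260 * t * a - 66 * t ^ 2 + 72 * t ^ 3 - 28 * s * G - 10 * s * F - 260 * s * a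
      + 164 * s * t - 124 * s * t ^ 2 + 10 * s ^ 2 + 260 * s ^ 2 * t - 28 * s ^ 3) * h5
  · simp only [map_add, map_sub, D.leibniz, D.leibniz_pow, smul_eq_mul, nsmul_eq_mul,
      D.map_ofNat_eq_zero, hs, ht, hρ']
    push_cast at h1 h3 ⊢
    linear_combination ρ * hS - S * hρ + ρ * h3 +
      ρ * (-4 * D G - 4 * F - 8 * D a + 14 * t + 8 * t * G + 88 * t * a - 31 * t ^ 2 + 24 * t ^ 3 -
      1 * s - 8 * s * G - 88 * s * a + 64 * s * t - 42 * s * t ^ 2 + 88 * s ^ 2 * t - 8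
      * s ^ 3) * h5

end Algebra

/-! ### The congruences -/

theorem reduceMod_theta_mul_sptSeriesEven (p : ℕ) :
    reduceMod p theta * reduceMod p sptSeriesEven =
      2 * reduceMod p (sigmaSeries 1 2) + 4 * reduceMod p (rankSeries 1) := by
  simpa only [map_add, map_sub, map_mul, map_ofNat] using
    congrArg (reduceMod p) theta_mul_sptSeriesEven

theorem reduceMod_theta_mul_sptSeries (p : ℕ) :
    reduceMod p theta * reduceMod p sptSeries = 2 * reduceMod p (sigmaSeries 1 1) -
      4 * reduceMod p (sigmaSeries 1 2) + 8 * reduceMod p (rankSeries 1) := by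
  simpa only [map_add, map_sub, map_mul, map_ofNat] using congrArg (reduceMod p) theta_mul_sptSeries

theorem qDeriv_reduceMod_theta (p : ℕ) : qDeriv (ZMod p) (reduceMod p theta) =
    2 * (reduceMod p (sigmaSeries 1 2) - reduceMod p (sigmaSeries 1 1)) * reduceMod p theta := by
  rw [← reduceMod_qDeriv, qDeriv_theta]
  simp only [map_sub, map_mul, map_ofNat]

theorem sptSeriesEven_add_qDeriv_mod_three :
    reduceMod 3 sptSeriesEven + qDeriv (ZMod 3) (reduceMod 3 sptSeriesEven) = 0 := by
  have hz : ∀ z : ZMod 3, z ^ 3 = z ^ 1 := by decide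
  have h4 : reduceMod 3 (sigmaSeries 3 2) = _ := reduceMod_sigmaSeries_congr hz (by norm_num)
  have h5 : reduceMod 3 (rankSeries (1 + 2)) = _ := reduceMod_rankSeries_congr hz
  -- t⁴ ≡ t² modulo 3, that is, D²θ ≡ Dθ.
  have h6 : reduceMod 3 (thetaMoment 4) = reduceMod 3 (thetaMoment 2) :=
    reduceMod_thetaMoment_congr (by decide)
  have h2 := congrArg (reduceMod 3) eight_mul_heatSeries_one
  rw [← qDeriv_thetaMoment 2, ← qDeriv_thetaMoment 0, ← theta] at h6
  simp only [heatSeries, map_mul, map_add, map_sub, map_ofNat, reduceMod_qDeriv, h4, h5] at h2 h6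
  exact add_derivation_eq_zero_of_three_eq_zero _ (natCast_eq_zero_powerSeries 3)
    (isUnit_reduceMod_theta 3) (reduceMod_theta_mul_sptSeriesEven 3) h2 h6

theorem exists_sptSeries_sub_eq_qDeriv_mod_three :
    ∃ H, reduceMod 3 sptSeries - 2 * reduceMod 3 sptSeriesEven = qDeriv (ZMod 3) H := by
  obtain ⟨ρ, hρ⟩ := (isUnit_reduceMod_theta 3).exists_right_inv
  exact ⟨ρ, sub_eq_derivation_of_three_eq_zero _ (natCast_eq_zero_powerSeries 3) hρ
    (qDeriv_reduceMod_theta 3) (reduceMod_theta_mul_sptSeriesEven 3)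
    (reduceMod_theta_mul_sptSeries 3)⟩

theorem exists_sptSeries_eq_qDeriv_mod_five :
    (∃ H, reduceMod 5 sptSeriesEven = qDeriv (ZMod 5) H - 3 * H) ∧
      ∃ H, reduceMod 5 sptSeries - reduceMod 5 sptSeriesEven = qDeriv (ZMod 5) H := by
  have h5 : (5 : (ZMod 5)⟦X⟧) = 0 := natCast_eq_zero_powerSeries 5
  have hz : ∀ z : ZMod 5, z ^ 5 = z ^ 1 := by decide
  have e1 : reduceMod 5 (sigmaSeries 5 2) = _ := reduceMod_sigmaSeries_congr hz (by norm_num)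
  have e2 : reduceMod 5 (rankSeries (3 + 2)) = _ := reduceMod_rankSeries_congr hz
  have h1 := congrArg (reduceMod 5) eight_mul_heatSeries_one
  have h3 := congrArg (reduceMod 5) twenty_four_mul_heatSeries_three
  have hs := congrArg (reduceMod 5) twelve_mul_sigmaSeries_sq
  have ht := congrArg (reduceMod 5) twelve_mul_sigmaSeries_two_sq
  simp only [heatSeries, map_mul, map_add, map_sub, map_pow, map_ofNat, reduceMod_qDeriv, e1, e2]
    at h1 h3 hs ht
  obtain ⟨ρ, hρ⟩ := (isUnit_reduceMod_theta 5).exists_right_inv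
  obtain ⟨h6, h7⟩ := eq_derivation_sub_of_five_eq_zero (qDeriv (ZMod 5)) h5 hρ
    (qDeriv_reduceMod_theta 5)
    -- Modulo 5 the cubic divisor sums drop out of Ramanujan's identity, leaving Ds = s - 2s² and Dt
    -- = t² + 2t.
    (by linear_combination hs + (reduceMod 5 (sigmaSeries 3 1) -
      qDeriv (ZMod 5) (reduceMod 5 (sigmaSeries 1 1)) -
      2 * reduceMod 5 (sigmaSeries 1 1) ^ 2) * h5)
    (by linear_combination 2 * ht + (2 * reduceMod 5 (sigmaSeries 3 2) -
      qDeriv (ZMod 5) (reduceMod 5 (sigmaSeries 1 2)) -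
      5 * reduceMod 5 (sigmaSeries 1 2) ^ 2) * h5) h1 h3
  refine ⟨h6 _ (reduceMod_theta_mul_sptSeriesEven 5), h7 _ ?_⟩
  linear_combination reduceMod_theta_mul_sptSeries 5 - reduceMod_theta_mul_sptSeriesEven 5

theorem sptBar2_mod_three (n : ℕ) (hn : (n : ZMod 3) + 1 ≠ 0) : (sptBar2 n : ZMod 3) = 0 := by
  have h := congrArg (coeff n) sptSeriesEven_add_qDeriv_mod_three
  rw [map_add, coeff_qDeriv, coeff_reduceMod_sptSeriesEven, map_zero] at h
  have : Fact (Nat.Prime 3) := ⟨Nat.prime_three⟩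
  refine (mul_eq_zero.mp ?_).resolve_left hn
  linear_combination h

theorem theorem1p3 :
    (∀ n : ℕ, sptBar2 (3 * n) ≡ 0 [MOD 3] ∧ sptBar2 (3 * n + 1) ≡ 0 [MOD 3]) ∧
    (∀ n : ℕ, sptBar (3 * n) ≡ 0 [MOD 3]) ∧
    (∀ n : ℕ, sptBar2 (5 * n + 3) ≡ 0 [MOD 5]) ∧
    (∀ n : ℕ, sptBar1 (5 * n) ≡ 0 [MOD 5]) := by
  simp only [Nat.modEq_zero_iff_dvd, ← ZMod.natCast_eq_zero_iff]
  have e3 : (3 : ZMod 3) = 0 := rfl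
  have e5 : (5 : ZMod 5) = 0 := rfl
  have h0 : ∀ n, (sptBar2 (3 * n) : ZMod 3) = 0 := fun n => sptBar2_mod_three _ (by
    push_cast
    rw [e3, zero_mul]
    decide)
  refine ⟨fun n => ⟨h0 n, sptBar2_mod_three _ ?_⟩, fun n => ?_, fun n => ?_, fun n => ?_⟩
  · push_cast
    rw [e3, zero_mul]
    decide
  · obtain ⟨H, hH⟩ := exists_sptSeries_sub_eq_qDeriv_mod_three
    have h := congrArg (coeff (3 * n)) hH
    rw [two_mul, map_sub, map_add, coeff_qDeriv, coeff_reduceMod_sptSeriesEven,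
      coeff_reduceMod_sptSeries, h0] at h
    push_cast at h
    linear_combination h + n * coeff (3 * n) H * e3
  · obtain ⟨H, hH⟩ := exists_sptSeries_eq_qDeriv_mod_five.1
    have h := congrArg (coeff (5 * n + 3)) hH
    rw [map_sub, coeff_qDeriv, coeff_reduceMod_sptSeriesEven, ← map_ofNat (C (R := ZMod 5)),
      coeff_C_mul] at h
    push_cast at h
    -- In degree 5n + 3 the operator D - 3 acts as 5n.
    linear_combination h + n * coeff (5 * n + 3) H * e5
  · obtain ⟨H, hH⟩ := exists_sptSeries_eq_qDeriv_mod_five.2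
    have h := congrArg (coeff (5 * n)) hH
    rw [map_sub, coeff_qDeriv, coeff_reduceMod_sptSeriesEven, coeff_reduceMod_sptSeries,
      sptBar] at h
    push_cast at h
    linear_combination h + n * coeff (5 * n) H * e5
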